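/- **Proposition (Exponential change of measure).** Fix $h>0$, let $\mathbb{Z}_h:=\{hk:k\in\mathbb{Z}\}$, and let $\mathbb{D}_h$ be the space of càdlàg paths $\omega:[0,\infty)\to\mathbb{Z}_h$, with coordinate process $X_t(\omega):=\omega(t)$, $\sigma$-algebra $\mathcal F=\sigma(X_s:s\ge 0)$ and natural filtration $\mathcal F_t=\sigma(X_s:s\in[0,t])$, $\mathbb F=(\mathcal F_t)_{t\ge0}$. Let $\mathsf P$ be a probability measure on $(\mathbb{D}_h,\mathcal F)$ under which $X$ is an *upwards skip-free Lévy chain*: a compound Poisson process (started at $0$, with increments independent relative to $\mathbb F$) whose (finite, nonzero) Lévy measure $\lambda$ satisfies $\mathrm{supp}(\lambda)\subset\mathbb{Z}_h$ and $\mathrm{supp}(\lambda|_{\mathcal B((0,\infty))})=\{h\}$. Let $\psi(\beta):=\int_{\mathbb R}(e^{\beta x}-1)\,\lambda(dx)$ ($\Re\beta\ge 0$) be its Laplace exponent, so that $\mathsf E[e^{\beta X_t}]=e^{t\psi(\beta)}$; let $\Phi(0)$ be the largest root of $\psi|_{[0,\infty)}$, and $\psi'(0+)\in[-\infty,\infty)$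 the right derivative of $\psi|_{[0,\infty)}$ at $0$. Let $c\ge 0$. Then: 1. There is a unique measure $\mathsf P_c$ on $\mathcal F$ such that $\mathsf P_c(\Lambda)=\mathsf E[e^{cX_t-\psi(c)t}\mathbf 1_\Lambda]$ for all $t\ge0$ and $\Lambda\in\mathcal F_t$. 2. Under $\mathsf P_c$, $X$ is again an upwards skip-free Lévy chain (with the same $h$), with Laplace exponent $\psi_c=\psi(\cdot+c)-\psi(c)$ on $\{\Re\beta\ge 0\}$. 3. If $c\ge\Phi(0)$, then $X_t\to+\infty$ as $t\to\infty$, $\mathsf P_c$-a.s., unless $c=\psi'(0+)=0$. 4. If $\lambda_c$ is the Lévy measure of $X$ under $\mathsf P_c$, then $\lambda_c\ll\lambda$ and $\frac{d\lambda_c}{d\lambda}(x)=e^{cx}$ for $\lambda$-a.e. $x\in\mathbb R$. 5. For every $\mathbb F$-stopping time $T$ (with values in $[0,\infty]$), $\mathsf P_c\ll\mathsf P$ on restriction to $\mathcal F_T':=\{A\cap\{T<\infty\}:A\in\mathcal F_T\}$, and $$\frac{d\mathsf P_c|_{\mathcal F_T'}}{d\mathsf P|_{\mathcal F_T'}}=e^{cX_T-\psi(c)T}.$$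 -/

import Mathlib

open MeasureTheory ProbabilityTheory Filter Topology
open scoped NNReal ENNReal

noncomputable section

/-- Right-continuous with left limits on `[0, ∞)` (at `t = 0` the left limit is no condition). -/
def IsCadlag (f : ℝ≥0 → ℝ) : Prop :=
  (∀ t, ContinuousWithinAt f (Set.Ici t) t) ∧ ∀ t, ∃ l : ℝ, Tendsto f (𝓝[<] t) (𝓝 l)

/-- The lattice `ℤ_h = {h k : k ∈ ℤ}`. -/
def latticeZ (h : ℝ) : Set ℝ := {x | ∃ k : ℤ, x = h * k}

/-- The canonical path space `𝔻_h` of càdlàg paths `[0, ∞) → ℤ_h`. As a subtype of the product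
`ℝ≥0 → ℝ` it carries the σ-algebra generated by the evaluation maps. -/
abbrev PathSpace (h : ℝ) : Type :=
  {ω : ℝ≥0 → ℝ // (∀ t, ω t ∈ latticeZ h) ∧ IsCadlag ω}

/-- The coordinate process on the canonical path space. -/
def coord (h : ℝ) (t : ℝ≥0) (ω : PathSpace h) : ℝ := ω.1 t

theorem measurable_coord (h : ℝ) (t : ℝ≥0) : Measurable (coord h t) :=
  (measurable_pi_apply t).comp measurable_subtype_coe

/-- The σ-algebra of the canonical path space is the one generated by the evaluation maps. -/
theorem pathSpace_measurableSpace_eq (h : ℝ) :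
    (inferInstance : MeasurableSpace (PathSpace h)) =
      ⨆ t, MeasurableSpace.comap (coord h t) inferInstance := by
  change MeasurableSpace.comap Subtype.val
    (⨆ t : ℝ≥0, MeasurableSpace.comap (fun f : ℝ≥0 → ℝ => f t) inferInstance) = _
  rw [MeasurableSpace.comap_iSup]
  simp only [MeasurableSpace.comap_comp]
  rfl

/-- The natural filtration `ℱ_t = σ(pr_s : s ≤ t)` of the coordinate process. -/
def canonicalFiltration (h : ℝ) :
    Filtration ℝ≥0 (inferInstance : MeasurableSpace (PathSpace h)) :=
  Filtration.natural (coord h) fun t => (measurable_coord h t).stronglyMeasurable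

/-- `X` is a (real-valued) Lévy process with respect to the filtration `𝔽` under `P`. -/
structure IsLevyProcess {Ω : Type*} {m : MeasurableSpace Ω} (𝔽 : Filtration ℝ≥0 m)
    (X : ℝ≥0 → Ω → ℝ) (P : Measure Ω) : Prop where
  isProbabilityMeasure : IsProbabilityMeasure P
  adapted : ∀ t, Measurable[𝔽 t] (X t)
  cadlag : ∀ᵐ ω ∂P, IsCadlag fun t => X t ω
  zero : ∀ᵐ ω ∂P, X 0 ω = 0
  stationary : ∀ s t, P.map (fun ω => X (s + t) ω - X s ω) = P.map (X t)
  indep : ∀ s t,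
    Indep (MeasurableSpace.comap (fun ω => X (s + t) ω - X s ω) inferInstance) (𝔽 s) P

/-- `X` is, under `P`, a compound Poisson process with Lévy measure `ν`: a Lévy process, with
`ν` a finite nonzero measure that does not charge `0`, such that
`E[exp(i p X_t)] = exp(t ∫ (exp(i p x) - 1) ν(dx))` for all `t ≥ 0` and real `p`. -/
structure IsCompoundPoisson {Ω : Type*} {m : MeasurableSpace Ω} (𝔽 : Filtration ℝ≥0 m)
    (X : ℝ≥0 → Ω → ℝ) (P : Measure Ω) (ν : Measure ℝ) : Prop where
  isLevyProcess : IsLevyProcess 𝔽 X P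
  isFiniteMeasure : IsFiniteMeasure ν
  ne_zero : ν ≠ 0
  no_atom_zero : ν {0} = 0
  charFun_eq : ∀ (t : ℝ≥0) (p : ℝ),
    charFun (P.map (X t)) p =
      Complex.exp (t * ∫ x, (Complex.exp (Complex.I * p * x) - 1) ∂ν)

/-- `X` is, under `P`, an upwards skip-free Lévy chain on `ℤ_h` with Lévy measure `ν`: a compound
Poisson process with `supp ν ⊆ ℤ_h` whose only possible upward jump is `h`. -/
structure IsUpwardsSkipFreeLevyChain {Ω : Type*} {m : MeasurableSpace Ω} (𝔽 : Filtration ℝ≥0 m)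
    (X : ℝ≥0 → Ω → ℝ) (P : Measure Ω) (ν : Measure ℝ) (h : ℝ) : Prop where
  isCompoundPoisson : IsCompoundPoisson 𝔽 X P ν
  pos : 0 < h
  support_subset : ν.support ⊆ latticeZ h
  support_restrict : (ν.restrict (Set.Ioi 0)).support = {h}

/-- The Laplace exponent `ψ(β) = ∫ (exp(β x) - 1) ν(dx)` at complex `β` with `Re β ≥ 0`. -/
def laplaceExponent (ν : Measure ℝ) (β : ℂ) : ℂ := ∫ x, (Complex.exp (β * x) - 1) ∂ν

/-- The Laplace exponent at real `β ≥ 0`. -/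
def laplaceExponentReal (ν : Measure ℝ) (β : ℝ) : ℝ := ∫ x, (Real.exp (β * x) - 1) ∂ν

theorem laplaceExponent_ofReal (ν : Measure ℝ) (β : ℝ) :
    laplaceExponent ν β = laplaceExponentReal ν β := by
  unfold laplaceExponent laplaceExponentReal
  rw [← integral_complex_ofReal]
  simp

/-- `Φ(0)`, the largest root of `ψ` on `[0, ∞)`. -/
def largestRoot (ν : Measure ℝ) : ℝ := sSup {β : ℝ | 0 ≤ β ∧ laplaceExponentReal ν β = 0}

/-- `φ` is the Laplace exponent of the process `X` under `Q`:
`E_Q[exp(β X_t)] = exp(t φ(β))` for `Re β ≥ 0`, `t ≥ 0`. -/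
def HasLaplaceExponent {Ω : Type*} {m : MeasurableSpace Ω} (X : ℝ≥0 → Ω → ℝ) (Q : Measure Ω)
    (φ : ℂ → ℂ) : Prop :=
  ∀ β : ℂ, 0 ≤ β.re → ∀ t : ℝ≥0,
    Integrable (fun ω => Complex.exp (β * X t ω)) Q ∧
      ∫ ω, Complex.exp (β * X t ω) ∂Q = Complex.exp (t * φ β)

/-- `Q(Λ) = E_P[exp(c X_t - ψ(c) t) 1_Λ]` for all `t ≥ 0` and `Λ ∈ ℱ_t`. -/
def IsExponentialChange (h : ℝ) (P : Measure (PathSpace h)) (ν : Measure ℝ) (c : ℝ)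
    (Q : Measure (PathSpace h)) : Prop :=
  ∀ (t : ℝ≥0) (Λ : Set (PathSpace h)), MeasurableSet[canonicalFiltration h t] Λ →
    Q Λ = ∫⁻ ω in Λ, ENNReal.ofReal (Real.exp (c * coord h t ω - laplaceExponentReal ν c * t)) ∂P

/-- The random variable `exp(c X_T - ψ(c) T)`, of interest only on `{T < ∞}`. -/
def stoppedDensity (h : ℝ) (ν : Measure ℝ) (c : ℝ) (T : PathSpace h → WithTop ℝ≥0)
    (ω : PathSpace h) : ℝ≥0∞ :=
  ENNReal.ofReal (Real.exp
    (c * stoppedValue (coord h) T ω - laplaceExponentReal ν c * ((T ω).untopA : ℝ≥0)))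

end

/-! ### Càdlàg paths -/

/-! The process exp(c X_t - ψ(c) t) is a mean-one martingale that factorises over increments.
Everything follows from this factorisation and the independence of increments.

Moments: matching characteristic functions identifies the law of X_t with an explicit Poisson
mixture of convolution powers of ν (`IsCompoundPoisson.map_eq`). The exponential moment formula then
holds for every β with exp(βx) ν-integrable, which includes Re β ≥ 0 because the jumps are bounded
above by h.

Existence: tilt the law of the path increment over each [k, k + 1], take the infinite product of
these laws and glue the pieces together. On ℱ_n only n pieces matter, and there the product law is
the tilted law (`withDensity_pathPiece_rectangle`). Uniqueness holds since the ℱ_t-events form a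
generating π-system. Stationarity and independence of increments survive because the density
factorises (`IsExpChange.measure_inter_increment`), and exp(cx) ν is the Lévy measure since it has
exponent ψ(· + c) - ψ(c) and Lévy measures are unique.

Drift: convexity of ψ and the atom of ν at h give ψ_c(θ) ≥ εθ for some ε > 0. Hence X_1 has mean at
least ε, the strong law handles integer times, and Borel–Cantelli excludes low excursions in
between.

Stopping times: approximating T from the right by grid times, Fatou gives one inequality in the
density formula. Since P is in turn an exponential change of the new measure, with parameters -c and
-ψ(c), the same inequality applied to the reversed pair gives the other. -/

theorem IsCadlag.comp_monotone {f : ℝ≥0 → ℝ} (hf : IsCadlag f) {φ : ℝ≥0 → ℝ≥0}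
    (hφ : Monotone φ) (hc : Continuous φ) : IsCadlag fun t => f (φ t) := by
  refine ⟨fun t => ?_, fun t => ?_⟩
  · exact (hf.1 (φ t)).comp hc.continuousWithinAt fun s hs => hφ hs
  · by_cases h : ∃ s < t, φ s = φ t
    · obtain ⟨s, hst, hs⟩ := h
      refine ⟨f (φ t), tendsto_const_nhds.congr' ?_⟩
      filter_upwards [Ioo_mem_nhdsLT hst] with u hu
      rw [le_antisymm (hφ hu.2.le) (hs ▸ hφ hu.1.le)]
    · push Not at h
      obtain ⟨l, hl⟩ := hf.2 (φ t)
      refine ⟨l, hl.comp (tendsto_nhdsWithin_iff.2 ⟨hc.continuousAt.mono_left inf_le_left, ?_⟩)⟩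
      filter_upwards [self_mem_nhdsWithin] with s hs
      exact lt_of_le_of_ne (hφ (le_of_lt hs)) (h s hs)

theorem IsCadlag.sub {f g : ℝ≥0 → ℝ} (hf : IsCadlag f) (hg : IsCadlag g) :
    IsCadlag fun t => f t - g t := by
  refine ⟨fun t => (hf.1 t).sub (hg.1 t), fun t => ?_⟩
  obtain ⟨l, hl⟩ := hf.2 t
  obtain ⟨m, hm⟩ := hg.2 t
  exact ⟨l - m, hl.sub hm⟩

theorem isCadlag_const (a : ℝ) : IsCadlag fun _ => a :=
  ⟨fun _ => continuousWithinAt_const, fun _ => ⟨a, tendsto_const_nhds⟩⟩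

theorem IsCadlag.sum {ι : Type*} (s : Finset ι) {f : ι → ℝ≥0 → ℝ} (hf : ∀ i ∈ s, IsCadlag (f i)) :
    IsCadlag fun t => ∑ i ∈ s, f i t := by
  refine ⟨fun t => ?_, fun t => ?_⟩
  · exact tendsto_finsetSum _ fun i hi => (hf i hi).1 t
  · have : ∀ i, ∃ l : ℝ, i ∈ s → Tendsto (f i) (𝓝[<] t) (𝓝 l) := fun i => by
      by_cases hi : i ∈ s
      · exact ((hf i hi).2 t).imp fun l hl _ => hl
      · exact ⟨0, fun h => absurd h hi⟩
    choose l hl using this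
    exact ⟨_, tendsto_finsetSum _ fun i hi => hl i hi⟩

/-- The property is local. This serves for concatenated paths, where the number of summands depends
on the time. -/
theorem IsCadlag.congr_Iio {f : ℝ≥0 → ℝ}
    (h : ∀ b : ℝ≥0, ∃ g, IsCadlag g ∧ ∀ t < b, f t = g t) : IsCadlag f := by
  refine ⟨fun t => ?_, fun t => ?_⟩ <;> obtain ⟨g, hg, hfg⟩ := h (t + 1)
  · have ht : t < t + 1 := by simp
    refine (hg.1 t).congr_of_eventuallyEq ?_ (hfg t ht)
    filter_upwards [mem_nhdsWithin_of_mem_nhds (Iio_mem_nhds ht)] with s hs using hfg s hs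
  · have ht : t < t + 1 := by simp
    obtain ⟨l, hl⟩ := hg.2 t
    refine ⟨l, hl.congr' ?_⟩
    filter_upwards [mem_nhdsWithin_of_mem_nhds (Iio_mem_nhds ht)] with s hs using (hfg s hs).symm

theorem latticeZ_zero_mem (h : ℝ) : (0 : ℝ) ∈ latticeZ h := ⟨0, by simp⟩

theorem latticeZ_sub_mem {h x y : ℝ} (hx : x ∈ latticeZ h) (hy : y ∈ latticeZ h) :
    x - y ∈ latticeZ h := by
  obtain ⟨a, rfl⟩ := hx
  obtain ⟨b, rfl⟩ := hy
  exact ⟨a - b, by push_cast; ring⟩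

theorem latticeZ_add_mem {h x y : ℝ} (hx : x ∈ latticeZ h) (hy : y ∈ latticeZ h) :
    x + y ∈ latticeZ h := by
  obtain ⟨a, rfl⟩ := hx
  obtain ⟨b, rfl⟩ := hy
  exact ⟨a + b, by push_cast; ring⟩

theorem latticeZ_sum_mem {h : ℝ} {ι : Type*} (s : Finset ι) {f : ι → ℝ}
    (hf : ∀ i ∈ s, f i ∈ latticeZ h) : ∑ i ∈ s, f i ∈ latticeZ h :=
  Finset.sum_induction f (· ∈ latticeZ h) (fun _ _ => latticeZ_add_mem) (latticeZ_zero_mem h) hf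

/-! ### The canonical filtration -/

theorem canonicalFiltration_apply (h : ℝ) (t : ℝ≥0) :
    canonicalFiltration h t = ⨆ s ≤ t, MeasurableSpace.comap (coord h s) inferInstance := by
  rfl

theorem measurable_coord_canonicalFiltration (h : ℝ) {s t : ℝ≥0} (hst : s ≤ t) :
    Measurable[canonicalFiltration h t] (coord h s) := by
  rw [canonicalFiltration_apply]
  exact measurable_iff_comap_le.2 (le_iSup₂ (f := fun s (_ : s ≤ t) =>
    MeasurableSpace.comap (coord h s) inferInstance) s hst)

theorem measurable_pathSpace_iff {h : ℝ} {Ω : Type*} {m : MeasurableSpace Ω}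
    {f : Ω → PathSpace h} : Measurable f ↔ ∀ t, Measurable fun ω => coord h t (f ω) := by
  refine ⟨fun hf t => (measurable_coord h t).comp hf, fun hf => ?_⟩
  exact Measurable.subtype_mk (measurable_pi_lambda _ hf)

/-- The path stopped at a deterministic time. -/
def stopPath (h : ℝ) (t : ℝ≥0) (ω : PathSpace h) : PathSpace h :=
  ⟨fun s => ω.1 (min s t), fun _ => ω.2.1 _,
    ω.2.2.comp_monotone (fun _ _ hab => min_le_min_right t hab) (by fun_prop)⟩

theorem canonicalFiltration_le_comap_stopPath (h : ℝ) (t : ℝ≥0) :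
    canonicalFiltration h t ≤ MeasurableSpace.comap (stopPath h t) inferInstance := by
  rw [canonicalFiltration_apply]
  refine iSup₂_le fun s hs => ?_
  have : coord h s = coord h s ∘ stopPath h t := by
    ext ω
    simp [coord, stopPath, hs]
  rw [this, ← MeasurableSpace.comap_comp]
  exact MeasurableSpace.comap_mono (measurable_coord h s).comap_le

/-- Galmarino's test: an event of ℱ_t is a preimage under stopping at t, so it cannot separate paths
that agree up to t. -/
theorem mem_iff_of_canonicalFiltration {h : ℝ} {t : ℝ≥0} {Λ : Set (PathSpace h)}
    (hΛ : MeasurableSet[canonicalFiltration h t] Λ) {ω ω' : PathSpace h}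
    (hω : ∀ s ≤ t, coord h s ω = coord h s ω') : ω ∈ Λ ↔ ω' ∈ Λ := by
  obtain ⟨S, -, rfl⟩ := canonicalFiltration_le_comap_stopPath h t _ hΛ
  have : stopPath h t ω = stopPath h t ω' := Subtype.ext (funext fun s => hω _ (min_le_right s t))
  simp only [Set.mem_preimage, this]

theorem pathSpace_measurableSpace_eq_generateFrom (h : ℝ) :
    (inferInstance : MeasurableSpace (PathSpace h)) =
      MeasurableSpace.generateFrom {A | ∃ t, MeasurableSet[canonicalFiltration h t] A} := by
  refine le_antisymm ?_ (MeasurableSpace.generateFrom_le ?_)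
  · refine (pathSpace_measurableSpace_eq h).trans_le (iSup_le fun t => ?_)
    rintro _ ⟨B, hB, rfl⟩
    exact MeasurableSpace.measurableSet_generateFrom
      ⟨t, measurable_coord_canonicalFiltration h le_rfl hB⟩
  · rintro A ⟨t, ht⟩
    exact (canonicalFiltration h).le t A ht

theorem isPiSystem_canonicalFiltration (h : ℝ) :
    IsPiSystem {A | ∃ t, MeasurableSet[canonicalFiltration h t] A} := by
  rintro A ⟨s, hs⟩ B ⟨t, ht⟩ -
  exact ⟨max s t, MeasurableSet.inter ((canonicalFiltration h).mono (le_max_left s t) _ hs)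
    ((canonicalFiltration h).mono (le_max_right s t) _ ht)⟩

/-! ### Independence of the future increments -/

/-- On the π-system of sets A ∩ B, the factor B splits off from A ∩ C first, and then A from C. -/
theorem indep_sup_left_of_indep {Ω : Type*} {m₁ m₂ m₃ m : MeasurableSpace Ω} {P : Measure Ω}
    [IsProbabilityMeasure P] (h₁ : m₁ ≤ m) (h₂ : m₂ ≤ m) (h₃ : m₃ ≤ m)
    (h12 : Indep m₁ m₂ P) (h3 : Indep m₃ (m₁ ⊔ m₂) P) : Indep (m₁ ⊔ m₃) m₂ P := by
  set p : Set (Set Ω) := {S | ∃ A B, MeasurableSet[m₁] A ∧ MeasurableSet[m₃] B ∧ S = A ∩ B}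
    with hp
  have hpi : IsPiSystem p := by
    rintro _ ⟨A, B, hA, hB, rfl⟩ _ ⟨A', B', hA', hB', rfl⟩ -
    exact ⟨A ∩ A', B ∩ B', hA.inter hA', hB.inter hB', Set.inter_inter_inter_comm _ _ _ _⟩
  have hgen : m₁ ⊔ m₃ = MeasurableSpace.generateFrom p := by
    refine le_antisymm (sup_le ?_ ?_) (MeasurableSpace.generateFrom_le ?_)
    · exact fun A hA => MeasurableSpace.measurableSet_generateFrom
        ⟨A, Set.univ, hA, MeasurableSet.univ, (Set.inter_univ A).symm⟩
    · exact fun A hA => MeasurableSpace.measurableSet_generateFrom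
        ⟨Set.univ, A, MeasurableSet.univ, hA, (Set.univ_inter A).symm⟩
    · rintro _ ⟨A, B, hA, hB, rfl⟩
      exact MeasurableSet.inter ((le_sup_left : m₁ ≤ m₁ ⊔ m₃) _ hA)
        ((le_sup_right : m₃ ≤ m₁ ⊔ m₃) _ hB)
  refine IndepSets.indep (sup_le h₁ h₃) h₂ hpi (@MeasurableSpace.isPiSystem_measurableSet Ω m₂) hgen
    (@MeasurableSpace.generateFrom_measurableSet Ω m₂).symm ?_
  rw [IndepSets_iff]
  rintro _ C ⟨A, B, hA, hB, rfl⟩ hC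
  rw [Indep_iff] at h12 h3
  have hAC : MeasurableSet[m₁ ⊔ m₂] (A ∩ C) := MeasurableSet.inter
    ((le_sup_left : m₁ ≤ m₁ ⊔ m₂) _ hA) ((le_sup_right : m₂ ≤ m₁ ⊔ m₂) _ hC)
  have e : A ∩ B ∩ C = B ∩ (A ∩ C) := by
    rw [Set.inter_comm A B, Set.inter_assoc]
  rw [e, h3 _ _ hB hAC, h12 _ _ hA hC, Set.inter_comm A B,
    h3 _ _ hB ((le_sup_left : m₁ ≤ m₁ ⊔ m₂) _ hA), mul_assoc]

/-- The definition only gives independence of a single increment from the past. Finite families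
follow by adding the largest time last and splitting its increment at the previous maximum; a
directed supremum then covers all times. -/
theorem IsLevyProcess.indep_future {Ω : Type*} {m : MeasurableSpace Ω} {𝔽 : Filtration ℝ≥0 m}
    {X : ℝ≥0 → Ω → ℝ} {P : Measure Ω} (hX : IsLevyProcess 𝔽 X P) (s : ℝ≥0) :
    Indep (⨆ u : ℝ≥0, MeasurableSpace.comap (fun ω => X (s + u) ω - X s ω) inferInstance)
      (𝔽 s) P := by
  have := hX.isProbabilityMeasure
  set D : ℝ≥0 → MeasurableSpace Ω :=
    fun u => MeasurableSpace.comap (fun ω => X (s + u) ω - X s ω) inferInstance with hD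
  have hmeas : ∀ {a b c}, a ≤ c → b ≤ c → Measurable[𝔽 c] fun ω => X a ω - X b ω :=
    fun ha hb => Measurable.sub ((hX.adapted _).mono (𝔽.mono ha) le_rfl)
      ((hX.adapted _).mono (𝔽.mono hb) le_rfl)
  have hDle : ∀ u, D u ≤ 𝔽 (s + u) := fun u =>
    (hmeas (c := s + u) le_rfl (by simp)).comap_le
  have key : ∀ J : Finset ℝ≥0, Indep (⨆ u ∈ J, D u) (𝔽 s) P := by
    intro J
    induction J using Finset.induction_on_max with
    | empty => simpa using indep_bot_left _
    | insert a J hJ ih =>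
      -- The previous maximum. For empty `J` it is 0, and then the increment up to s + b vanishes
      -- and generates the trivial σ-algebra.
      set b : ℝ≥0 := J.sup id
      have hba : b ≤ a := Finset.sup_le fun x hx => (hJ x hx).le
      have hle : (⨆ u ∈ J, D u) ≤ 𝔽 (s + b) := iSup₂_le fun u hu =>
        (hDle u).trans (𝔽.mono (by gcongr; exact Finset.le_sup (f := id) hu))
      have hDb : D b ≤ ⨆ u ∈ J, D u := by
        rcases J.eq_empty_or_nonempty with rfl | hne
        · have : b = 0 := by simp [b]
          rw [this]
          simp [hD]
        · obtain ⟨x, hx, hxb⟩ := Finset.exists_mem_eq_sup J hne id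
          have : b ∈ J := by rw [show b = x from hxb]; exact hx
          exact le_iSup₂ (f := fun u (_ : u ∈ J) => D u) b this
      have hinc := hX.indep (s + b) (a - b)
      rw [add_assoc, add_tsub_cancel_of_le hba] at hinc
      have h3 := indep_of_indep_of_le_right hinc
        (sup_le hle (𝔽.mono (by simp)) : (⨆ u ∈ J, D u) ⊔ 𝔽 s ≤ 𝔽 (s + b))
      have hfin := indep_sup_left_of_indep (hle.trans (𝔽.le _)) (𝔽.le s)
        ((hmeas (a := s + a) (b := s + b) (c := s + a) le_rfl (by gcongr)).comap_le.trans (𝔽.le _)) ih h3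
      refine indep_of_indep_of_le_left hfin ?_
      rw [Finset.iSup_insert]
      refine sup_le ?_ le_sup_left
      refine Measurable.comap_le (m₁ := (⨆ u ∈ J, D u) ⊔ _) ?_
      have e : (fun ω => X (s + a) ω - X s ω) =
          fun ω => (X (s + b) ω - X s ω) + (X (s + a) ω - X (s + b) ω) := by
        ext ω; ring
      rw [e]
      refine Measurable.add ?_ ?_
      · exact measurable_iff_comap_le.2 (hDb.trans le_sup_left)
      · exact measurable_iff_comap_le.2 le_sup_right
  rw [iSup_eq_iSup_finset]
  refine indep_iSup_of_directed_le key ?_ (𝔽.le s) ?_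
  · exact fun J => iSup₂_le fun u _ => (hDle u).trans (𝔽.le _)
  · exact directed_of_isDirected_le fun J K hJK => biSup_mono fun u hu => Finset.mem_of_subset hJK hu

/-! ### Compound Poisson laws -/

/-- The `n`-fold convolution power of a measure on `ℝ`. -/
noncomputable def convPow (ν : Measure ℝ) : ℕ → Measure ℝ
  | 0 => Measure.dirac 0
  | n + 1 => ν ∗ convPow ν n

instance instIsFiniteMeasureConvPow (ν : Measure ℝ) [IsFiniteMeasure ν] :
    ∀ n, IsFiniteMeasure (convPow ν n)
  | 0 => inferInstanceAs (IsFiniteMeasure (Measure.dirac 0))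
  | n + 1 => by
    have := instIsFiniteMeasureConvPow ν n
    exact inferInstanceAs (IsFiniteMeasure (ν ∗ convPow ν n))

/-- The compound Poisson law `∑ₙ exp(-t|ν|) tⁿ/n! ν^{*n}`. -/
noncomputable def compoundPoissonLaw (ν : Measure ℝ) (t : ℝ≥0) : Measure ℝ :=
  Measure.sum fun n : ℕ =>
    ENNReal.ofReal (Real.exp (-(t * ν.real Set.univ)) * ((t : ℝ) ^ n / n.factorial)) • convPow ν n

/-- A multiplicative function turns convolution into a product of integrals. The scalar field is
left general so that the result applies both to complex exponentials and to their norms. -/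
theorem integrable_convPow_and_integral {ν : Measure ℝ} [IsFiniteMeasure ν] {𝕜 : Type*} [RCLike 𝕜]
    {f : ℝ → 𝕜}
    (hf : Measurable f) (hmul : ∀ x y, f (x + y) = f x * f y) (h0 : f 0 = 1)
    (hint : Integrable f ν) (n : ℕ) :
    Integrable f (convPow ν n) ∧ ∫ x, f x ∂(convPow ν n) = (∫ x, f x ∂ν) ^ n := by
  induction n with
  | zero =>
    simp only [convPow, pow_zero, integral_dirac, h0, and_true]
    exact integrable_dirac (by simp)
  | succ n ih =>
    have hi : Integrable f (ν ∗ convPow ν n) := by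
      rw [integrable_conv_iff hf.aestronglyMeasurable]
      simp only [hmul, norm_mul, integral_const_mul]
      exact ⟨ae_of_all _ fun x => ih.1.const_mul _, hint.norm.mul_const _⟩
    refine ⟨hi, ?_⟩
    simp only [convPow]
    rw [integral_conv hi]
    simp only [hmul, integral_const_mul, integral_mul_const, ih.2]
    ring

theorem integrable_compoundPoissonLaw {ν : Measure ℝ} [IsFiniteMeasure ν] {f : ℝ → ℂ}
    (hf : Measurable f) (hmul : ∀ x y, f (x + y) = f x * f y) (h0 : f 0 = 1)
    (hint : Integrable f ν) (t : ℝ≥0) : Integrable f (compoundPoissonLaw ν t) := by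
  refine ⟨hf.aestronglyMeasurable, ?_⟩
  have hreal := fun n => integrable_convPow_and_integral (ν := ν) (f := fun x => ‖f x‖) hf.norm
    (fun x y => by simp [hmul]) (by simp [h0]) hint.norm n
  rw [hasFiniteIntegral_iff_norm, compoundPoissonLaw, lintegral_sum_measure]
  simp only [lintegral_smul_measure, smul_eq_mul]
  have e : ∀ n : ℕ,
      ENNReal.ofReal (Real.exp (-(t * ν.real Set.univ)) * ((t : ℝ) ^ n / n.factorial)) *
        ∫⁻ x, ENNReal.ofReal ‖f x‖ ∂(convPow ν n) =
      ENNReal.ofReal (Real.exp (-(t * ν.real Set.univ)) *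
        ((t * ∫ x, ‖f x‖ ∂ν) ^ n / n.factorial)) := by
    intro n
    rw [← ofReal_integral_eq_lintegral_ofReal (hreal n).1 (ae_of_all _ fun x => norm_nonneg _),
      (hreal n).2, ← ENNReal.ofReal_mul (by positivity)]
    congr 1
    rw [mul_pow]
    ring
  simp only [e]
  have hI : 0 ≤ ∫ x, ‖f x‖ ∂ν := integral_nonneg fun x => norm_nonneg _
  rw [← ENNReal.ofReal_tsum_of_nonneg (fun n => by positivity)
    ((Real.summable_pow_div_factorial _).mul_left _)]
  exact ENNReal.ofReal_lt_top

/-- Summing over the number of jumps gives the exponential series of t ∫ f dν; the factor exp(-t|ν|)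
accounts for the subtracted 1. -/
theorem integral_compoundPoissonLaw {ν : Measure ℝ} [IsFiniteMeasure ν] {f : ℝ → ℂ}
    (hf : Measurable f) (hmul : ∀ x y, f (x + y) = f x * f y) (h0 : f 0 = 1)
    (hint : Integrable f ν) (t : ℝ≥0) :
    ∫ x, f x ∂(compoundPoissonLaw ν t) = Complex.exp (t * ∫ x, (f x - 1) ∂ν) := by
  have hsum := hasSum_integral_measure (integrable_compoundPoissonLaw hf hmul h0 hint t)
  refine hsum.unique ?_
  have hexp := (NormedSpace.expSeries_div_hasSum_exp ((t : ℂ) * ∫ x, f x ∂ν)).mul_left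
    (Complex.exp (-(t * ν.real Set.univ)))
  rw [← Complex.exp_eq_exp_ℂ, ← Complex.exp_add] at hexp
  have e1 : -((t : ℂ) * (ν.real Set.univ : ℂ)) + t * ∫ x, f x ∂ν = t * ∫ x, (f x - 1) ∂ν := by
    rw [integral_sub hint (integrable_const _), integral_const]
    simp
    ring
  rw [e1] at hexp
  convert! hexp using 2 with n
  rw [integral_smul_measure, (integrable_convPow_and_integral hf hmul h0 hint n).2,
    ENNReal.toReal_ofReal (by positivity), Complex.real_smul]
  push_cast
  rw [mul_pow]
  ring

instance instIsFiniteMeasureCompoundPoissonLaw (ν : Measure ℝ) [IsFiniteMeasure ν] (t : ℝ≥0) :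
    IsFiniteMeasure (compoundPoissonLaw ν t) :=
  (integrable_const_iff_isFiniteMeasure (c := (1 : ℂ)) one_ne_zero).1
    (integrable_compoundPoissonLaw measurable_const (by simp) rfl (integrable_const 1) t)

section

variable {Ω : Type*} {m : MeasurableSpace Ω} {𝔽 : Filtration ℝ≥0 m}
    {X : ℝ≥0 → Ω → ℝ} {P : Measure Ω} {ν : Measure ℝ}

theorem IsCompoundPoisson.measurable (hX : IsCompoundPoisson 𝔽 X P ν) (t : ℝ≥0) :
    Measurable (X t) :=
  (hX.isLevyProcess.adapted t).mono (𝔽.le t) le_rfl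

/-- This passes from imaginary exponents, the only ones in the definition, to all integrable ones,
without analytic continuation. -/
theorem IsCompoundPoisson.map_eq (hX : IsCompoundPoisson 𝔽 X P ν) (t : ℝ≥0) :
    P.map (X t) = compoundPoissonLaw ν t := by
  have := hX.isLevyProcess.isProbabilityMeasure
  have := hX.isFiniteMeasure
  refine Measure.ext_of_charFun (funext fun p => ?_)
  have hexp : ∀ x : ℝ, Complex.exp (p * x * Complex.I) = Complex.exp (Complex.I * p * x) :=
    fun x => by ring_nf
  rw [hX.charFun_eq, charFun_apply_real]
  simp only [hexp]
  rw [integral_compoundPoissonLaw (by fun_prop) (fun x y => by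
    rw [← Complex.exp_add]; push_cast; ring_nf) (by simp)]
  refine Integrable.of_bound (C := 1) (by fun_prop) (ae_of_all _ fun x => ?_)
  rw [← hexp]
  simpa using (Complex.norm_exp_ofReal_mul_I (p * x)).le

/-- Exponential moments of a compound Poisson process. -/
theorem IsCompoundPoisson.integral_exp (hX : IsCompoundPoisson 𝔽 X P ν) {β : ℂ}
    (hβ : Integrable (fun x : ℝ => Complex.exp (β * x)) ν) (t : ℝ≥0) :
    Integrable (fun ω => Complex.exp (β * X t ω)) P ∧
      ∫ ω, Complex.exp (β * X t ω) ∂P = Complex.exp (t * laplaceExponent ν β) := by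
  have := hX.isFiniteMeasure
  have hm : Measurable fun x : ℝ => Complex.exp (β * x) := by fun_prop
  have hmul : ∀ x y : ℝ, Complex.exp (β * (x + y : ℝ)) =
      Complex.exp (β * x) * Complex.exp (β * y) := fun x y => by
    rw [← Complex.exp_add]; push_cast; ring_nf
  have hi := integrable_compoundPoissonLaw hm hmul (by simp) hβ t
  have he := integral_compoundPoissonLaw hm hmul (by simp) hβ t
  rw [← hX.map_eq] at hi he
  rw [integrable_map_measure hm.aestronglyMeasurable (hX.measurable t).aemeasurable] at hi
  rw [integral_map (hX.measurable t).aemeasurable hm.aestronglyMeasurable] at he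
  exact ⟨hi, he⟩

end

/-- The right derivatives at t = 0 are compared, which avoids the branches of the complex logarithm.
-/
theorem exp_mul_sub_injective {a b : ℂ}
    (h : ∀ t : ℝ≥0, Complex.exp (t * a) = Complex.exp (t * b)) : a = b := by
  have hd : ∀ z : ℂ, HasDerivWithinAt (fun t : ℝ => Complex.exp (t * z)) z (Set.Ici 0) 0 := by
    intro z
    have h1 : HasDerivAt (fun t : ℝ => (t : ℂ) * z) (1 * z) 0 :=
      (Complex.ofRealCLM.hasDerivAt (x := 0)).mul_const z
    have := h1.cexp
    simpa using this.hasDerivWithinAt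
  refine (uniqueDiffOn_Ici (0 : ℝ) 0 Set.self_mem_Ici).eq_deriv _ (hd a)
    ((hd b).congr (fun t ht => ?_) ?_)
  · exact h ⟨t, ht⟩
  · simp

/-- The Lévy measure of a compound Poisson process is determined by its law. -/
theorem measure_eq_of_integral_exp_sub_one_eq {μ ν : Measure ℝ} [IsFiniteMeasure μ]
    [IsFiniteMeasure ν] (hμ : μ {0} = 0) (hν : ν {0} = 0)
    (h : ∀ p : ℝ, ∫ x, (Complex.exp (Complex.I * p * x) - 1) ∂μ =
      ∫ x, (Complex.exp (Complex.I * p * x) - 1) ∂ν) : μ = ν := by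
  have hexp : ∀ p x : ℝ, Complex.exp (p * x * Complex.I) = Complex.exp (Complex.I * p * x) :=
    fun p x => by ring_nf
  have hint : ∀ (ρ : Measure ℝ) [IsFiniteMeasure ρ] (p : ℝ),
      Integrable (fun x : ℝ => Complex.exp (Complex.I * p * x)) ρ := fun ρ _ p => by
    refine Integrable.of_bound (C := 1) (by fun_prop) (ae_of_all _ fun x => ?_)
    rw [← hexp]
    simpa using (Complex.norm_exp_ofReal_mul_I (p * x)).le
  -- The exponent fixes the Fourier transform only up to the total mass. Moving the masses across as
  -- atoms at 0 gives two finite measures with equal characteristic functions; away from 0 the added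
  -- atoms disappear.
  have key : μ + ν Set.univ • Measure.dirac 0 = ν + μ Set.univ • Measure.dirac 0 := by
    have := Measure.smul_finite (Measure.dirac (0 : ℝ)) (measure_ne_top ν Set.univ)
    have := Measure.smul_finite (Measure.dirac (0 : ℝ)) (measure_ne_top μ Set.univ)
    refine Measure.ext_of_charFun (funext fun p => ?_)
    have hp := h p
    rw [integral_sub (hint μ p) (integrable_const _), integral_sub (hint ν p) (integrable_const _),
      integral_const, integral_const] at hp
    simp only [charFun_apply_real, hexp]
    rw [integral_add_measure (hint _ p) (hint _ p), integral_add_measure (hint _ p) (hint _ p),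
      integral_smul_measure, integral_smul_measure, integral_dirac]
    simp only [Measure.real] at hp
    simp only [Complex.real_smul, mul_one, Complex.ofReal_zero, mul_zero, Complex.exp_zero] at hp ⊢
    linear_combination hp
  ext s hs
  have h1 := congrArg (fun ρ : Measure ℝ => ρ (s \ {0})) key
  simp only [Measure.add_apply, Measure.smul_apply, smul_eq_mul] at h1
  rw [Measure.dirac_apply' _ (hs.diff (measurableSet_singleton 0))] at h1
  simp only [Set.mem_sdiff, Set.mem_singleton_iff, not_true_eq_false, and_false, not_false_eq_true,
    Set.indicator_of_notMem, mul_zero, add_zero] at h1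
  rwa [measure_sdiff_null hμ, measure_sdiff_null hν] at h1

/-! ### The Laplace exponent of a measure whose only upward jump is `h` -/

section

variable {ν : Measure ℝ} {h : ℝ}

theorem ae_le_of_support_restrict (hν : (ν.restrict (Set.Ioi 0)).support = {h}) (hh : 0 < h) :
    ∀ᵐ x ∂ν, x ≤ h := by
  have h0 := Measure.measure_compl_support (μ := ν.restrict (Set.Ioi 0))
  rw [hν, Measure.restrict_apply (measurableSet_singleton h).compl] at h0
  filter_upwards [measure_eq_zero_iff_ae_notMem.1 h0] with x hx
  by_contra! hlt
  exact hx ⟨fun hxh => hlt.ne' hxh, hh.trans hlt⟩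

/-- Without mass at h the restricted measure would vanish on its support as well as off it, hence be
zero and have empty support. -/
theorem measure_singleton_pos_of_support_restrict
    (hν : (ν.restrict (Set.Ioi 0)).support = {h}) : 0 < ν {h} := by
  rw [pos_iff_ne_zero]
  intro h1
  have h0 := Measure.measure_compl_support (μ := ν.restrict (Set.Ioi 0))
  rw [hν] at h0
  have h2 : ν.restrict (Set.Ioi 0) {h} = 0 :=
    le_antisymm ((Measure.restrict_le_self _).trans h1.le) zero_le
  have h3 : ν.restrict (Set.Ioi 0) = 0 := by
    rw [← Measure.measure_univ_eq_zero, ← Set.union_compl_self {h}]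
    exact measure_union_null h2 h0
  rw [h3] at hν
  simp at hν

theorem laplaceExponentReal_zero : laplaceExponentReal ν 0 = 0 := by
  simp [laplaceExponentReal]

variable [IsFiniteMeasure ν]

theorem integrable_cexp_of_ae_le (hle : ∀ᵐ x ∂ν, x ≤ h) {β : ℂ} (hβ : 0 ≤ β.re) :
    Integrable (fun x : ℝ => Complex.exp (β * x)) ν := by
  refine Integrable.of_bound (C := Real.exp (β.re * h)) (by fun_prop) ?_
  filter_upwards [hle] with x hx
  rw [Complex.norm_exp]
  simp only [Complex.mul_re, Complex.ofReal_re, Complex.ofReal_im, mul_zero, sub_zero]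
  gcongr

theorem integrable_exp_of_ae_le (hle : ∀ᵐ x ∂ν, x ≤ h) {β : ℝ} (hβ : 0 ≤ β) :
    Integrable (fun x : ℝ => Real.exp (β * x)) ν := by
  refine Integrable.of_bound (C := Real.exp (β * h)) (by fun_prop) ?_
  filter_upwards [hle] with x hx
  rw [Real.norm_of_nonneg (Real.exp_pos _).le]
  gcongr

theorem integrable_exp_sub_one_of_ae_le (hle : ∀ᵐ x ∂ν, x ≤ h) {β : ℝ} (hβ : 0 ≤ β) :
    Integrable (fun x : ℝ => Real.exp (β * x) - 1) ν :=
  (integrable_exp_of_ae_le hle hβ).sub (integrable_const _)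

theorem convexOn_laplaceExponentReal (hle : ∀ᵐ x ∂ν, x ≤ h) :
    ConvexOn ℝ (Set.Ici 0) (laplaceExponentReal ν) := by
  refine ⟨convex_Ici 0, fun a ha b hb s t hs ht hst => ?_⟩
  have hA := integrable_exp_sub_one_of_ae_le hle ha
  have hB := integrable_exp_sub_one_of_ae_le hle hb
  have hmem : 0 ≤ s * a + t * b := by
    have := mul_nonneg hs ha
    have := mul_nonneg ht hb
    linarith
  simp only [laplaceExponentReal, smul_eq_mul]
  rw [← integral_const_mul, ← integral_const_mul,
    ← integral_add (hA.const_mul s) (hB.const_mul t)]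
  refine integral_mono (integrable_exp_sub_one_of_ae_le hle hmem)
    ((hA.const_mul s).add (hB.const_mul t)) fun x => ?_
  have := convexOn_exp.2 (Set.mem_univ (a * x)) (Set.mem_univ (b * x)) hs ht hst
  simp only [smul_eq_mul] at this
  have e : s * (a * x) + t * (b * x) = (s * a + t * b) * x := by ring
  rw [e] at this
  simp only
  linear_combination this + hst

/-- Only the atom at h is kept in the integral of exp(βx). The resulting growth bounds the roots of
ψ, so that the `sSup` in `largestRoot` is a genuine supremum. -/
theorem laplaceExponentReal_ge (hle : ∀ᵐ x ∂ν, x ≤ h) {β : ℝ} (hβ : 0 ≤ β) :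
    Real.exp (β * h) * ν.real {h} - ν.real Set.univ ≤ laplaceExponentReal ν β := by
  have hi := integrable_exp_of_ae_le hle hβ
  have : laplaceExponentReal ν β = ∫ x, Real.exp (β * x) ∂ν - ν.real Set.univ := by
    rw [laplaceExponentReal, integral_sub hi (integrable_const _)]
    simp
  rw [this]
  gcongr
  calc Real.exp (β * h) * ν.real {h} = ∫ x in {h}, Real.exp (β * x) ∂ν := by
        rw [integral_singleton, smul_eq_mul, mul_comm]
    _ ≤ _ := setIntegral_le_integral hi (ae_of_all _ fun x => (Real.exp_pos _).le)

theorem exists_forall_laplaceExponentReal_pos (hle : ∀ᵐ x ∂ν, x ≤ h) (hh : 0 < h)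
    (hpos : 0 < ν {h}) : ∃ B, ∀ β, B ≤ β → 0 < laplaceExponentReal ν β := by
  have hr : 0 < ν.real {h} := ENNReal.toReal_pos hpos.ne' (measure_ne_top _ _)
  have ht : Tendsto (fun β : ℝ => Real.exp (β * h) * ν.real {h}) atTop atTop :=
    (Real.tendsto_exp_atTop.comp (tendsto_id.atTop_mul_const hh)).atTop_mul_const hr
  obtain ⟨B, hB⟩ := eventually_atTop.1 (ht.eventually_gt_atTop (ν.real Set.univ))
  refine ⟨max B 0, fun β hβ => ?_⟩
  have h1 := hB β ((le_max_left _ _).trans hβ)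
  have h2 := laplaceExponentReal_ge hle ((le_max_right _ _).trans hβ)
  linarith

theorem le_largestRoot (hle : ∀ᵐ x ∂ν, x ≤ h) (hh : 0 < h) (hpos : 0 < ν {h}) {β : ℝ}
    (hβ : 0 ≤ β) (h0 : laplaceExponentReal ν β = 0) : β ≤ largestRoot ν := by
  obtain ⟨B, hB⟩ := exists_forall_laplaceExponentReal_pos hle hh hpos
  refine le_csSup ⟨B, fun x hx => ?_⟩ ⟨hβ, h0⟩
  by_contra! hlt
  exact (hB x hlt.le).ne' hx.2

/-- If ψ(c) < 0, eventual positivity and the intermediate value theorem give a root at or beyond c,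
which must be c itself. Taking c > 0 allows continuity to be read off from convexity in the
interior. -/
theorem laplaceExponentReal_nonneg_of_largestRoot_le (hle : ∀ᵐ x ∂ν, x ≤ h) (hh : 0 < h)
    (hpos : 0 < ν {h}) {c : ℝ} (hc : 0 < c) (hr : largestRoot ν ≤ c) :
    0 ≤ laplaceExponentReal ν c := by
  by_contra! hneg
  obtain ⟨B, hB⟩ := exists_forall_laplaceExponentReal_pos hle hh hpos
  have hcB : c ≤ max B c := le_max_right _ _
  have hcont : ContinuousOn (laplaceExponentReal ν) (Set.Icc c (max B c)) := by
    have := (convexOn_laplaceExponentReal hle).continuousOn_interior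
    rw [interior_Ici] at this
    exact this.mono fun x hx => hc.trans_le hx.1
  obtain ⟨β, hβ, hβ0⟩ := intermediate_value_Icc hcB hcont
    ⟨hneg.le, (hB _ (le_max_left _ _)).le⟩
  have hβc := (le_largestRoot hle hh hpos (hc.le.trans hβ.1) hβ0).trans hr
  rw [le_antisymm hβc hβ.1] at hβ0
  exact hneg.ne hβ0

/-- The difference is ∫ (exp(cx/2) - 1)² dν, positive because of the atom at h. Together with ψ(c) ≥
0 it yields ψ(c/2) < ψ(c). -/
theorem two_mul_laplaceExponentReal_half_lt (hle : ∀ᵐ x ∂ν, x ≤ h) (hh : 0 < h)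
    (hpos : 0 < ν {h}) {c : ℝ} (hc : 0 < c) :
    2 * laplaceExponentReal ν (c / 2) < laplaceExponentReal ν c := by
  have h1 := integrable_exp_sub_one_of_ae_le hle hc.le
  have h2 := integrable_exp_sub_one_of_ae_le hle (half_pos hc).le
  rw [← sub_pos, laplaceExponentReal, laplaceExponentReal, ← integral_const_mul,
    ← integral_sub h1 (h2.const_mul 2)]
  have e : ∀ x : ℝ, Real.exp (c * x) - 1 - 2 * (Real.exp (c / 2 * x) - 1) =
      (Real.exp (c / 2 * x) - 1) ^ 2 := fun x => by
    have : Real.exp (c * x) = Real.exp (c / 2 * x) ^ 2 := by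
      rw [← Real.exp_nat_mul]; congr 1; push_cast; ring
    rw [this]; ring
  have hi := h1.sub (h2.const_mul 2)
  have hi' : Integrable (fun x => (Real.exp (c / 2 * x) - 1) ^ 2) ν := by
    refine hi.congr (ae_of_all _ fun x => ?_)
    simpa using e x
  simp only [e]
  rw [integral_pos_iff_support_of_nonneg (fun x => sq_nonneg _) hi']
  refine hpos.trans_le (measure_mono ?_)
  rintro x rfl
  have : 1 < Real.exp (c / 2 * x) := Real.one_lt_exp_iff.2 (by positivity)
  exact pow_ne_zero 2 (by linarith)

/-- At `c ≥ Φ(0)` the Laplace exponent has a positive right slope, except when `c = 0` and its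
right derivative at `0` vanishes. -/
theorem exists_pos_slope_laplaceExponentReal (hle : ∀ᵐ x ∂ν, x ≤ h) (hh : 0 < h)
    (hpos : 0 < ν {h}) {c : ℝ} (hc : 0 ≤ c) (hr : largestRoot ν ≤ c)
    (hne : ¬ (c = 0 ∧ HasDerivWithinAt (laplaceExponentReal ν) 0 (Set.Ici 0) 0)) :
    ∃ ε > 0, ∀ θ, 0 ≤ θ →
      ε * θ ≤ laplaceExponentReal ν (c + θ) - laplaceExponentReal ν c := by
  have hconv := convexOn_laplaceExponentReal hle
  rcases hc.eq_or_lt with rfl | hc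
  · have hnd : ¬ HasDerivWithinAt (laplaceExponentReal ν) 0 (Set.Ici 0) 0 := fun hd => hne ⟨rfl, hd⟩
    have hnn : ∀ θ, 0 ≤ θ → 0 ≤ laplaceExponentReal ν θ := fun θ hθ => by
      rcases hθ.eq_or_lt with rfl | hθ
      · exact laplaceExponentReal_zero.ge
      · exact laplaceExponentReal_nonneg_of_largestRoot_le hle hh hpos hθ (hr.trans hθ.le)
    simp only [zero_add, laplaceExponentReal_zero, sub_zero]
    -- Otherwise each ε admits θ₀ > 0 with ψ(θ₀) < εθ₀. Convexity gives 0 ≤ ψ(θ) ≤ εθ on [0, θ₀), so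
    -- the right derivative at 0 would vanish.
    by_contra! hcon
    refine hnd ?_
    rw [hasDerivWithinAt_iff_isLittleO, Asymptotics.isLittleO_iff]
    intro ε hε
    obtain ⟨θ₀, hθ₀, hlt⟩ := hcon ε hε
    have hθ₀' : 0 < θ₀ := lt_of_le_of_ne hθ₀ fun h0 => by
      rw [← h0, laplaceExponentReal_zero] at hlt
      simp at hlt
    filter_upwards [self_mem_nhdsWithin, mem_nhdsWithin_of_mem_nhds (Iio_mem_nhds hθ₀')]
      with θ hθ hθlt
    have hθ : 0 ≤ θ := hθ
    have hθlt : θ < θ₀ := hθlt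
    simp only [laplaceExponentReal_zero, sub_zero, smul_zero, Real.norm_eq_abs,
      abs_of_nonneg (hnn θ hθ), abs_of_nonneg hθ]
    have := hconv.2 (Set.mem_Ici.2 le_rfl) (Set.mem_Ici.2 hθ₀)
      (show 0 ≤ 1 - θ / θ₀ by rw [sub_nonneg, div_le_one hθ₀']; exact hθlt.le)
      (show 0 ≤ θ / θ₀ by positivity) (by ring)
    simp only [smul_eq_mul, mul_zero, zero_add, laplaceExponentReal_zero] at this
    rw [div_mul_cancel₀ _ hθ₀'.ne'] at this
    calc _ ≤ θ / θ₀ * laplaceExponentReal ν θ₀ := this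
      _ ≤ θ / θ₀ * (ε * θ₀) := by gcongr
      _ = ε * θ := by field_simp
  · have h1 := laplaceExponentReal_nonneg_of_largestRoot_le hle hh hpos hc hr
    have h2 := two_mul_laplaceExponentReal_half_lt hle hh hpos hc
    -- The slope over [c/2, c] bounds all slopes to the right of c from below.
    refine ⟨(laplaceExponentReal ν c - laplaceExponentReal ν (c / 2)) / (c - c / 2),
      div_pos (by linarith) (by linarith), fun θ hθ => ?_⟩
    rcases hθ.eq_or_lt with rfl | hθ
    · simp
    · have := hconv.slope_mono_adjacent (x := c / 2) (y := c) (z := c + θ)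
        (Set.mem_Ici.2 (by linarith)) (Set.mem_Ici.2 (by linarith)) (by linarith) (by linarith)
      rw [add_sub_cancel_left] at this
      exact (le_div_iff₀ hθ).1 this

end

/-! ### Exponential densities -/

/-- The density `exp(c x - ψ t)` at a point `x` and time `t`. -/
noncomputable def expDensity (c ψ : ℝ) (t : ℝ≥0) (x : ℝ) : ℝ≥0∞ :=
  ENNReal.ofReal (Real.exp (c * x - ψ * t))

theorem measurable_expDensity (c ψ : ℝ) (t : ℝ≥0) : Measurable (expDensity c ψ t) := by
  unfold expDensity; fun_prop

theorem expDensity_add (c ψ : ℝ) (s t : ℝ≥0) (x y : ℝ) :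
    expDensity c ψ (s + t) y = expDensity c ψ s x * expDensity c ψ t (y - x) := by
  rw [expDensity, expDensity, expDensity, ← ENNReal.ofReal_mul (Real.exp_pos _).le, ← Real.exp_add]
  push_cast
  congr 2
  ring

section

variable {Ω : Type*} {m : MeasurableSpace Ω} {𝔽 : Filtration ℝ≥0 m} {X : ℝ≥0 → Ω → ℝ}
  {P : Measure Ω} {c ψ : ℝ}

theorem IsLevyProcess.lintegral_mul_increment (hX : IsLevyProcess 𝔽 X P) {s u : ℝ≥0}
    {f : Ω → ℝ≥0∞} (hf : Measurable[𝔽 s] f) {g : ℝ → ℝ≥0∞} (hg : Measurable g) :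
    ∫⁻ ω, f ω * g (X (s + u) ω - X s ω) ∂P = (∫⁻ ω, f ω ∂P) * ∫⁻ ω, g (X u ω) ∂P := by
  have hm : ∀ t, Measurable (X t) := fun t => (hX.adapted t).mono (𝔽.le t) le_rfl
  have hd : Measurable fun ω => X (s + u) ω - X s ω := (hm _).sub (hm _)
  have key := lintegral_mul_eq_lintegral_mul_lintegral_of_independent_measurableSpace (𝔽.le s)
    hd.comap_le (hX.indep s u).symm hf (hg.comp (comap_measurable _))
  simp only [Function.comp_apply] at key
  rw [key, ← lintegral_map hg hd, hX.stationary, lintegral_map hg (hm u)]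

/-- The martingale property of the density process: the factor contributed by the increment after s
is independent of ℱ_s and has mean one. -/
theorem IsLevyProcess.setLIntegral_expDensity_eq (hX : IsLevyProcess 𝔽 X P)
    (h1 : ∀ t, ∫⁻ ω, expDensity c ψ t (X t ω) ∂P = 1) {s t : ℝ≥0} (hst : s ≤ t)
    {Λ : Set Ω} (hΛ : MeasurableSet[𝔽 s] Λ) :
    ∫⁻ ω in Λ, expDensity c ψ t (X t ω) ∂P = ∫⁻ ω in Λ, expDensity c ψ s (X s ω) ∂P := by
  obtain ⟨u, rfl⟩ := exists_add_of_le hst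
  rw [← lintegral_indicator (𝔽.le s _ hΛ), ← lintegral_indicator (𝔽.le s _ hΛ)]
  have hf : Measurable[𝔽 s] (Λ.indicator fun ω => expDensity c ψ s (X s ω)) :=
    Measurable.indicator ((measurable_expDensity c ψ s).comp (hX.adapted s)) hΛ
  have := hX.lintegral_mul_increment (u := u) hf (measurable_expDensity c ψ u)
  rw [h1, mul_one] at this
  rw [← this]
  refine lintegral_congr fun ω => ?_
  by_cases hω : ω ∈ Λ
  · simp only [Set.indicator_of_mem hω]
    exact expDensity_add c ψ s u _ _
  · simp [hω]

end

/-! ### Concatenation of paths -/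

/-- The increment of a path over `[k, k + 1]`, as a path. -/
def pathPiece (h : ℝ) (k : ℕ) (ω : PathSpace h) : PathSpace h :=
  ⟨fun s => ω.1 (k + min s 1) - ω.1 k, fun _ => latticeZ_sub_mem (ω.2.1 _) (ω.2.1 _),
    (ω.2.2.comp_monotone (φ := fun s => (k : ℝ≥0) + min s 1)
      (fun _ _ hab => add_le_add_right (min_le_min_right 1 hab) (k : ℝ≥0)) (by fun_prop)).sub
      (isCadlag_const _)⟩

/-- The constant path `0`. -/
def zeroPath (h : ℝ) : PathSpace h := ⟨fun _ => 0, fun _ => latticeZ_zero_mem h, isCadlag_const 0⟩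

/-- The value at time `t` of the path which over `[k, k + 1]` has the increment of `w k` over
`[0, 1]`. -/
noncomputable def concatFun (h : ℝ) (w : ℕ → PathSpace h) (t : ℝ≥0) : ℝ :=
  ∑ j ∈ Finset.range ⌈t⌉₊, ((w j).1 (min (t - j) 1) - (w j).1 0)

/-- Pieces starting at or after t contribute nothing, because the subtraction t - j truncates to 0.
-/
theorem concatFun_eq_sum {h : ℝ} (w : ℕ → PathSpace h) {t : ℝ≥0} {n : ℕ} (htn : t ≤ n) :
    concatFun h w t = ∑ j ∈ Finset.range n, ((w j).1 (min (t - j) 1) - (w j).1 0) := by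
  refine Finset.sum_subset (Finset.range_subset_range.2 (Nat.ceil_le.2 htn)) fun j _ hj => ?_
  have : t ≤ j := Nat.ceil_le.1 (not_lt.1 fun h => hj (Finset.mem_range.2 h))
  simp [tsub_eq_zero_of_le this]

/-- Concatenation of the increments over `[0, 1]` of a sequence of paths. -/
noncomputable def concatPath (h : ℝ) (w : ℕ → PathSpace h) : PathSpace h :=
  ⟨concatFun h w,
    fun _ => latticeZ_sum_mem _ fun j _ => latticeZ_sub_mem ((w j).2.1 _) ((w j).2.1 _),
    IsCadlag.congr_Iio fun b => ⟨_, IsCadlag.sum (Finset.range ⌈b⌉₊) fun j _ =>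
      ((w j).2.2.comp_monotone (φ := fun t => min (t - (j : ℝ≥0)) 1)
        (fun _ _ hab => min_le_min_right 1 (tsub_le_tsub_right hab _)) (by fun_prop)).sub
        (isCadlag_const _),
      fun t ht => concatFun_eq_sum w (ht.le.trans (Nat.le_ceil b))⟩⟩

theorem measurable_concatPath (h : ℝ) : Measurable (concatPath h) := by
  refine measurable_pathSpace_iff.2 fun t => ?_
  change Measurable fun w => concatFun h w t
  refine Finset.measurable_sum _ fun j _ => ?_
  exact ((measurable_coord h _).comp (measurable_pi_apply j)).sub
    ((measurable_coord h _).comp (measurable_pi_apply j))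

theorem concatPath_congr {h : ℝ} {w w' : ℕ → PathSpace h} {n : ℕ} (hw : ∀ j < n, w j = w' j)
    {t : ℝ≥0} (ht : t ≤ n) : coord h t (concatPath h w) = coord h t (concatPath h w') := by
  change concatFun h w t = concatFun h w' t
  rw [concatFun_eq_sum w ht, concatFun_eq_sum w' ht]
  exact Finset.sum_congr rfl fun j hj => by rw [hw j (Finset.mem_range.1 hj)]

theorem coord_concatPath_pathPiece {h : ℝ} (ω : PathSpace h) (t : ℝ≥0) :
    coord h t (concatPath h fun j => pathPiece h j ω) = coord h t ω - coord h 0 ω := by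
  change concatFun h _ t = _
  rw [concatFun_eq_sum _ (Nat.le_ceil t)]
  have : ∀ j : ℕ, (pathPiece h j ω).1 (min (t - j) 1) - (pathPiece h j ω).1 0 =
      ω.1 (min t (j + 1 : ℕ)) - ω.1 (min t j) := by
    intro j
    simp only [pathPiece, min_assoc, min_self, zero_le, min_eq_left, add_zero, sub_self, sub_zero]
    rcases le_total t j with htj | hjt
    · have : t ≤ (j + 1 : ℕ) := htj.trans (by push_cast; simp)
      rw [min_eq_left htj, min_eq_left this]
      simp [tsub_eq_zero_of_le htj]
    · rw [min_eq_right hjt, ← min_add_add_left, add_tsub_cancel_of_le hjt, Nat.cast_add_one]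
  rw [Finset.sum_congr rfl fun j _ => this j,
    Finset.sum_range_sub (fun j : ℕ => ω.1 (min t (j : ℝ≥0)))]
  simp [coord, min_eq_left (Nat.le_ceil t)]

theorem comap_pathPiece_le (h : ℝ) (k : ℕ) :
    MeasurableSpace.comap (pathPiece h k) inferInstance ≤
      ⨆ u : ℝ≥0, MeasurableSpace.comap (fun ω => coord h (k + u) ω - coord h k ω) inferInstance := by
  refine measurable_iff_comap_le.1 ((@measurable_pathSpace_iff h _ (_) _).2 fun t => ?_)
  exact measurable_iff_comap_le.2 (le_iSup (fun u : ℝ≥0 =>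
    MeasurableSpace.comap (fun ω => coord h (k + u) ω - coord h k ω) inferInstance) (min t 1))

theorem measurable_pathPiece (h : ℝ) (k : ℕ) {t : ℝ≥0} (ht : (k + 1 : ℝ≥0) ≤ t) :
    Measurable[canonicalFiltration h t] (pathPiece h k) := by
  refine (@measurable_pathSpace_iff h _ (_) _).2 fun s => ?_
  exact Measurable.sub
    (measurable_coord_canonicalFiltration h (le_trans (by gcongr; exact min_le_right s 1) ht))
    (measurable_coord_canonicalFiltration h (le_trans (by simp) ht))

/-! ### Existence of the changed measure -/

section

variable {h : ℝ} {P : Measure (PathSpace h)} {c ψ : ℝ}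

/-- The law of the `k`-th piece of the path under the changed measure. -/
noncomputable def pieceLaw (h : ℝ) (P : Measure (PathSpace h)) (c ψ : ℝ) (k : ℕ) :
    Measure (PathSpace h) :=
  (P.withDensity fun ω => expDensity c ψ 1 (coord h (k + 1) ω - coord h k ω)).map (pathPiece h k)

theorem measurable_pathPiece' (h : ℝ) (k : ℕ) : Measurable (pathPiece h k) :=
  (measurable_pathPiece h k le_rfl).mono ((canonicalFiltration h).le _) le_rfl

theorem isProbabilityMeasure_pieceLaw
    (hX : IsLevyProcess (canonicalFiltration h) (coord h) P)
    (h1 : ∀ t, ∫⁻ ω, expDensity c ψ t (coord h t ω) ∂P = 1) (k : ℕ) :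
    IsProbabilityMeasure (pieceLaw h P c ψ k) := by
  have := hX.isProbabilityMeasure
  refine ⟨?_⟩
  rw [pieceLaw, Measure.map_apply (measurable_pathPiece' h k) MeasurableSet.univ, Set.preimage_univ,
    withDensity_apply _ MeasurableSet.univ, Measure.restrict_univ]
  have := hX.lintegral_mul_increment (s := k) (u := 1) (f := fun _ => 1) measurable_const
    (measurable_expDensity c ψ 1)
  simpa [h1] using this

/-- Under the law tilted up to time n, the first n pieces are independent with laws `pieceLaw`: the
density is a product over unit increments, and each piece is independent of the past. -/
theorem withDensity_pathPiece_rectangle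
    (hX : IsLevyProcess (canonicalFiltration h) (coord h) P)
    (h1 : ∀ t, ∫⁻ ω, expDensity c ψ t (coord h t ω) ∂P = 1) {B : ℕ → Set (PathSpace h)}
    (hB : ∀ k, MeasurableSet (B k)) (n : ℕ) :
    MeasurableSet[canonicalFiltration h n] {ω | ∀ j < n, pathPiece h j ω ∈ B j} ∧
    ∫⁻ ω in {ω | ∀ j < n, pathPiece h j ω ∈ B j}, expDensity c ψ n (coord h n ω) ∂P =
      ∏ j ∈ Finset.range n, pieceLaw h P c ψ j (B j) := by
  have hmeas : ∀ n : ℕ,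
      MeasurableSet[canonicalFiltration h n] {ω | ∀ j < n, pathPiece h j ω ∈ B j} := fun n => by
    have e : {ω | ∀ j < n, pathPiece h j ω ∈ B j} = ⋂ j < n, pathPiece h j ⁻¹' B j := by
      ext ω; simp
    rw [e]
    refine MeasurableSet.biInter (Set.to_countable _) fun j hj => ?_
    exact measurable_pathPiece h j (by exact_mod_cast hj) (hB j)
  refine ⟨hmeas n, ?_⟩
  induction n with
  | zero => simpa using h1 0
  | succ n ih =>
    rw [Finset.prod_range_succ, ← ih]
    set A : Set (PathSpace h) := {ω | ∀ j < n, pathPiece h j ω ∈ B j}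
    set g : PathSpace h → ℝ≥0∞ := (pathPiece h n ⁻¹' B n).indicator
      fun ω => expDensity c ψ 1 (coord h (n + 1) ω - coord h n ω)
    have hle : (⨆ u : ℝ≥0, MeasurableSpace.comap
        (fun ω => coord h (n + u) ω - coord h n ω) inferInstance) ≤
        (inferInstance : MeasurableSpace (PathSpace h)) :=
      iSup_le fun u => ((measurable_coord h _).sub (measurable_coord h _)).comap_le
    have hg : Measurable[⨆ u : ℝ≥0, MeasurableSpace.comap
        (fun ω => coord h (n + u) ω - coord h n ω) inferInstance] g := by
      refine Measurable.indicator ?_ (comap_pathPiece_le h n _ ⟨B n, hB n, rfl⟩)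
      refine (measurable_expDensity c ψ 1).comp (measurable_iff_comap_le.2 ?_)
      exact le_iSup (fun u : ℝ≥0 => MeasurableSpace.comap
        (fun ω => coord h (n + u) ω - coord h n ω) inferInstance) 1
    have hf : Measurable[canonicalFiltration h n]
        (A.indicator fun ω => expDensity c ψ n (coord h n ω)) :=
      Measurable.indicator ((measurable_expDensity c ψ n).comp
        (measurable_coord_canonicalFiltration h le_rfl)) (hmeas n)
    have key := lintegral_mul_eq_lintegral_mul_lintegral_of_independent_measurableSpace
      ((canonicalFiltration h).le n) hle (hX.indep_future n).symm hf hg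
    have hBn := measurable_pathPiece' h n (hB n)
    rw [lintegral_indicator ((canonicalFiltration h).le n _ (hmeas n)),
      lintegral_indicator hBn] at key
    have e2 : pieceLaw h P c ψ n (B n) = ∫⁻ ω in pathPiece h n ⁻¹' B n,
        expDensity c ψ 1 (coord h (n + 1) ω - coord h n ω) ∂P := by
      rw [pieceLaw, Measure.map_apply (measurable_pathPiece' h n) (hB n), withDensity_apply _ hBn]
    rw [e2, ← key, ← lintegral_indicator ((canonicalFiltration h).le _ _ (hmeas (n + 1)))]
    refine lintegral_congr fun ω => ?_
    have hiff : (ω ∈ {ω | ∀ j < n + 1, pathPiece h j ω ∈ B j}) ↔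
        ω ∈ A ∧ ω ∈ pathPiece h n ⁻¹' B n := by
      simp only [Set.mem_ofPred_eq, Nat.forall_lt_succ_right, A, Set.mem_preimage]
    by_cases hA : ω ∈ A <;> by_cases hBω : ω ∈ pathPiece h n ⁻¹' B n
    · rw [Set.indicator_of_mem (hiff.2 ⟨hA, hBω⟩)]
      simp only [g, Set.indicator_of_mem hA, Set.indicator_of_mem hBω]
      have := expDensity_add c ψ n 1 (coord h n ω) (coord h (n + 1) ω)
      simpa using this
    all_goals
      rw [Set.indicator_of_notMem (fun hh => by have := hiff.1 hh; tauto)]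
      simp [g, hA, hBω]

/-- Existence of the exponentially changed measure. -/
theorem exists_measure_eq_setLIntegral_expDensity
    (hX : IsLevyProcess (canonicalFiltration h) (coord h) P)
    (h1 : ∀ t, ∫⁻ ω, expDensity c ψ t (coord h t ω) ∂P = 1) :
    ∃ Q : Measure (PathSpace h), ∀ (t : ℝ≥0) (Λ : Set (PathSpace h)),
      MeasurableSet[canonicalFiltration h t] Λ →
        Q Λ = ∫⁻ ω in Λ, expDensity c ψ t (coord h t ω) ∂P := by
  have hprob := isProbabilityMeasure_pieceLaw hX h1
  set Q : Measure (PathSpace h) := (Measure.infinitePi (pieceLaw h P c ψ)).map (concatPath h)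
  -- Integer times suffice by the martingale property.
  suffices hn : ∀ (n : ℕ) (Λ : Set (PathSpace h)), MeasurableSet[canonicalFiltration h n] Λ →
      Q Λ = ∫⁻ ω in Λ, expDensity c ψ n (coord h n ω) ∂P by
    refine ⟨Q, fun t Λ hΛ => ?_⟩
    have ht : t ≤ ⌈t⌉₊ := Nat.le_ceil t
    rw [hn ⌈t⌉₊ Λ ((canonicalFiltration h).mono ht _ hΛ),
      hX.setLIntegral_expDensity_eq h1 ht hΛ]
  intro n Λ hΛ
  have hΛm := (canonicalFiltration h).le n _ hΛ
  set R : Measure (PathSpace h) := P.withDensity fun ω => expDensity c ψ n (coord h n ω)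
  set pieces : PathSpace h → (Finset.range n → PathSpace h) := fun ω j => pathPiece h j ω
  have hpieces : Measurable pieces := measurable_pi_lambda _ fun j => measurable_pathPiece' h j
  have hpi : Measure.pi (fun j : Finset.range n => pieceLaw h P c ψ j) = R.map pieces := by
    refine Measure.pi_eq fun s hs => ?_
    classical
    set B : ℕ → Set (PathSpace h) := fun j => if hj : j ∈ Finset.range n then s ⟨j, hj⟩ else Set.univ
    have hB : ∀ j, MeasurableSet (B j) := fun j => by
      simp only [B]
      split_ifs with hj
      exacts [hs _, MeasurableSet.univ]
    have hBs : ∀ j : Finset.range n, s j = B j := fun j => by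
      simp only [B, dif_pos j.2]
    obtain ⟨hm, hr⟩ := withDensity_pathPiece_rectangle hX h1 hB n
    have hpre : pieces ⁻¹' Set.univ.pi s = {ω | ∀ j < n, pathPiece h j ω ∈ B j} := by
      ext ω
      simp only [Set.mem_preimage, Set.mem_pi, Set.mem_univ, true_implies, Set.mem_ofPred_eq, pieces,
        hBs, Subtype.forall, Finset.mem_range]
    rw [Measure.map_apply hpieces (MeasurableSet.univ_pi hs), hpre,
      withDensity_apply _ ((canonicalFiltration h).le n _ hm), hr, ← Finset.prod_coe_sort]
    simp only [hBs]
  classical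
  set extend : (Finset.range n → PathSpace h) → ℕ → PathSpace h :=
    fun w j => if hj : j ∈ Finset.range n then w ⟨j, hj⟩ else zeroPath h
  have hext : Measurable extend := by
    refine measurable_pi_lambda _ fun j => ?_
    by_cases hj : j ∈ Finset.range n
    · simp only [extend, hj, dif_pos]
      exact measurable_pi_apply _
    · simp only [extend, hj, dif_neg, not_false_eq_true]
      exact measurable_const
  -- Membership in Λ ∈ ℱ_n depends on the first n pieces only, so the infinite product reduces to a
  -- finite one.
  have hpre : concatPath h ⁻¹' Λ = (Finset.range n).restrict ⁻¹' ((concatPath h ∘ extend) ⁻¹' Λ) := by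
    ext w
    refine mem_iff_of_canonicalFiltration hΛ fun t ht => concatPath_congr (fun j hj => ?_) ht
    simp [extend, hj]
  have hS : MeasurableSet ((concatPath h ∘ extend) ⁻¹' Λ) :=
    ((measurable_concatPath h).comp hext) hΛm
  rw [Measure.map_apply (measurable_concatPath h) hΛm, hpre,
    ← Measure.map_apply (Finset.measurable_restrict _) hS, Measure.infinitePi_map_restrict, hpi,
    Measure.map_apply hpieces hS, withDensity_apply _ (hpieces hS)]
  refine setLIntegral_congr ?_
  -- Gluing the pieces recovers X - X_0 up to time n, which is X almost surely.
  filter_upwards [hX.zero] with ω hω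
  refine propext (mem_iff_of_canonicalFiltration hΛ fun t ht => ?_)
  have e := concatPath_congr (w := extend (pieces ω)) (w' := fun j => pathPiece h j ω) (n := n)
    (fun j hj => by simp [extend, pieces, hj]) ht
  rw [Function.comp_apply, e, coord_concatPath_pathPiece, hω, sub_zero]

end

/-! ### The process under the changed measure -/

theorem IsCompoundPoisson.lintegral_expDensity {Ω : Type*} {m : MeasurableSpace Ω}
    {𝔽 : Filtration ℝ≥0 m} {X : ℝ≥0 → Ω → ℝ} {P : Measure Ω} {ν : Measure ℝ}
    (hX : IsCompoundPoisson 𝔽 X P ν) {c : ℝ}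
    (hc : Integrable (fun x : ℝ => Complex.exp (c * x)) ν) (t : ℝ≥0) :
    ∫⁻ ω, expDensity c (laplaceExponentReal ν c) t (X t ω) ∂P = 1 := by
  obtain ⟨hi, he⟩ := hX.integral_exp hc t
  have e : ∀ ω, Real.exp (c * X t ω - laplaceExponentReal ν c * t) =
      Real.exp (c * X t ω) * Real.exp (-(laplaceExponentReal ν c * t)) := fun ω => by
    rw [← Real.exp_add, sub_eq_add_neg]
  have hre : ∀ ω, Complex.exp (c * X t ω) = ((Real.exp (c * X t ω) : ℝ) : ℂ) := fun ω => by
    push_cast; rfl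
  simp only [hre] at hi he
  rw [integral_complex_ofReal, laplaceExponent_ofReal] at he
  have he' : ∫ ω, Real.exp (c * X t ω) ∂P = Real.exp (t * laplaceExponentReal ν c) := by
    exact_mod_cast he
  have hi' : Integrable (fun ω => Real.exp (c * X t ω)) P := by
    exact hi.re
  simp only [expDensity]
  rw [← ofReal_integral_eq_lintegral_ofReal _ (ae_of_all _ fun ω => (Real.exp_pos _).le)]
  · simp only [e, integral_mul_const, he']
    rw [← Real.exp_add]
    simp [mul_comm]
  · simp only [e]
    exact hi'.mul_const _

/-- `Q(Λ) = E_P[exp(c X_t - ψ t) 1_Λ]` for all `t` and `Λ ∈ ℱ_t`. -/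
def IsExpChange (h : ℝ) (P : Measure (PathSpace h)) (c ψ : ℝ) (Q : Measure (PathSpace h)) : Prop :=
  ∀ (t : ℝ≥0) (Λ : Set (PathSpace h)), MeasurableSet[canonicalFiltration h t] Λ →
    Q Λ = ∫⁻ ω in Λ, expDensity c ψ t (coord h t ω) ∂P

section

variable {h : ℝ} {P Q Q' : Measure (PathSpace h)} {c ψ : ℝ}

theorem IsExpChange.isProbabilityMeasure (hQ : IsExpChange h P c ψ Q)
    (h1 : ∀ t, ∫⁻ ω, expDensity c ψ t (coord h t ω) ∂P = 1) : IsProbabilityMeasure Q :=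
  ⟨by rw [hQ 0 _ MeasurableSet.univ, Measure.restrict_univ, h1]⟩

theorem IsExpChange.unique (hQ : IsExpChange h P c ψ Q) (hQ' : IsExpChange h P c ψ Q')
    (h1 : ∀ t, ∫⁻ ω, expDensity c ψ t (coord h t ω) ∂P = 1) : Q = Q' := by
  have := hQ.isProbabilityMeasure h1
  refine ext_of_generate_finite _ (pathSpace_measurableSpace_eq_generateFrom h)
    (isPiSystem_canonicalFiltration h) ?_ ?_
  · rintro Λ ⟨t, ht⟩
    rw [hQ t Λ ht, hQ' t Λ ht]
  · rw [hQ 0 _ MeasurableSet.univ, hQ' 0 _ MeasurableSet.univ]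

theorem measurable_expDensity_coord (c ψ : ℝ) {s t : ℝ≥0} (hst : s ≤ t) :
    Measurable[canonicalFiltration h t] fun ω => expDensity c ψ s (coord h s ω) :=
  (measurable_expDensity c ψ s).comp (measurable_coord_canonicalFiltration h hst)

theorem IsExpChange.trim_eq (hQ : IsExpChange h P c ψ Q) (t : ℝ≥0) :
    Q.trim ((canonicalFiltration h).le t) =
      (P.withDensity fun ω => expDensity c ψ t (coord h t ω)).trim
        ((canonicalFiltration h).le t) := by
  refine @Measure.ext _ (canonicalFiltration h t) _ _ fun Λ hΛ => ?_
  rw [trim_measurableSet_eq _ hΛ, trim_measurableSet_eq _ hΛ, hQ t Λ hΛ,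
    withDensity_apply _ ((canonicalFiltration h).le t _ hΛ)]

theorem IsExpChange.lintegral_eq (hQ : IsExpChange h P c ψ Q) {t : ℝ≥0}
    {f : PathSpace h → ℝ≥0∞} (hf : Measurable[canonicalFiltration h t] f) :
    ∫⁻ ω, f ω ∂Q = ∫⁻ ω, expDensity c ψ t (coord h t ω) * f ω ∂P := by
  rw [← lintegral_trim ((canonicalFiltration h).le t) hf, hQ.trim_eq, lintegral_trim _ hf,
    lintegral_withDensity_eq_lintegral_mul _
      ((measurable_expDensity_coord c ψ le_rfl).mono ((canonicalFiltration h).le t) le_rfl)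
      (hf.mono ((canonicalFiltration h).le t) le_rfl)]
  rfl

theorem IsExpChange.map_coord (hQ : IsExpChange h P c ψ Q) (t : ℝ≥0) :
    Q.map (coord h t) =
      (P.withDensity fun ω => expDensity c ψ t (coord h t ω)).map (coord h t) := by
  ext B hB
  have hm := measurable_coord_canonicalFiltration h (le_refl t) hB
  rw [Measure.map_apply (measurable_coord h t) hB, Measure.map_apply (measurable_coord h t) hB,
    hQ t _ hm, withDensity_apply _ (measurable_coord h t hB)]

/-- The density at s + u is the density at s times that of the increment. Taking A to be everything
gives stationarity, and general A then gives independence. -/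
theorem IsExpChange.measure_inter_increment (hQ : IsExpChange h P c ψ Q)
    (hX : IsLevyProcess (canonicalFiltration h) (coord h) P) (s u : ℝ≥0) {A : Set (PathSpace h)}
    (hA : MeasurableSet[canonicalFiltration h s] A) {B : Set ℝ} (hB : MeasurableSet B) :
    Q (A ∩ (fun ω => coord h (s + u) ω - coord h s ω) ⁻¹' B) = Q A * Q (coord h u ⁻¹' B) := by
  have hA' := (canonicalFiltration h).le s _ hA
  have hd : Measurable[canonicalFiltration h (s + u)] fun ω => coord h (s + u) ω - coord h s ω :=
    Measurable.sub (measurable_coord_canonicalFiltration h le_rfl)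
      (measurable_coord_canonicalFiltration h (by simp))
  have hAB : MeasurableSet[canonicalFiltration h (s + u)]
      (A ∩ (fun ω => coord h (s + u) ω - coord h s ω) ⁻¹' B) :=
    MeasurableSet.inter ((canonicalFiltration h).mono (by simp) _ hA) (hd hB)
  have hf : Measurable[canonicalFiltration h s]
      (A.indicator fun ω => expDensity c ψ s (coord h s ω)) :=
    Measurable.indicator (measurable_expDensity_coord c ψ le_rfl) hA
  have key := hX.lintegral_mul_increment (u := u) hf
    (((measurable_expDensity c ψ u)).indicator hB)
  rw [hQ _ _ hAB, hQ _ _ hA, hQ u _ (measurable_coord_canonicalFiltration h le_rfl hB),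
    ← lintegral_indicator ((canonicalFiltration h).le _ _ hAB), ← lintegral_indicator hA',
    ← lintegral_indicator (measurable_coord h u hB)]
  refine Eq.trans (lintegral_congr fun ω => ?_) (key.trans (congrArg _ (lintegral_congr fun ω => ?_)))
  · by_cases h1 : ω ∈ A <;> by_cases h2 : coord h (s + u) ω - coord h s ω ∈ B
    · simp only [Set.indicator, Set.mem_inter_iff, Set.mem_preimage, h1, h2, and_self, if_true]
      exact expDensity_add c ψ s u _ _
    all_goals simp [Set.indicator, h1, h2]
  · rfl

theorem IsExpChange.isLevyProcess (hQ : IsExpChange h P c ψ Q)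
    (hX : IsLevyProcess (canonicalFiltration h) (coord h) P)
    (h1 : ∀ t, ∫⁻ ω, expDensity c ψ t (coord h t ω) ∂P = 1) :
    IsLevyProcess (canonicalFiltration h) (coord h) Q := by
  have hprob := hQ.isProbabilityMeasure h1
  have hd : ∀ s t, Measurable fun ω => coord h (s + t) ω - coord h s ω := fun s t =>
    (measurable_coord h _).sub (measurable_coord h _)
  have huniv : ∀ s t (B : Set ℝ), MeasurableSet B →
      Q ((fun ω => coord h (s + t) ω - coord h s ω) ⁻¹' B) = Q (coord h t ⁻¹' B) :=
    fun s t B hB => by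
      have := hQ.measure_inter_increment hX s t MeasurableSet.univ hB
      rwa [Set.univ_inter, measure_univ, one_mul] at this
  refine ⟨hprob, fun t => measurable_coord_canonicalFiltration h le_rfl,
    ae_of_all _ fun ω => ω.2.2, ?_, fun s t => ?_, fun s t => ?_⟩
  · have hm : MeasurableSet[canonicalFiltration h 0] (coord h 0 ⁻¹' {0}ᶜ) :=
      measurable_coord_canonicalFiltration h le_rfl (measurableSet_singleton 0).compl
    have h0 : Q (coord h 0 ⁻¹' {0}ᶜ) = 0 := by
      rw [hQ 0 _ hm]
      exact setLIntegral_measure_zero _ _ hX.zero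
    exact h0
  · ext B hB
    rw [Measure.map_apply (hd s t) hB, Measure.map_apply (measurable_coord h t) hB, huniv s t B hB]
  · rw [Indep_iff]
    rintro _ A ⟨B, hB, rfl⟩ hA
    rw [Set.inter_comm, hQ.measure_inter_increment hX s t hA hB, huniv s t B hB, mul_comm]

theorem IsExpChange.integral_exp {ν : Measure ℝ}
    (hQ : IsExpChange h P c (laplaceExponentReal ν c) Q)
    (hX : IsCompoundPoisson (canonicalFiltration h) (coord h) P ν) {β : ℂ}
    (hβ : Integrable (fun x : ℝ => Complex.exp ((β + c) * x)) ν) (t : ℝ≥0) :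
    Integrable (fun ω => Complex.exp (β * coord h t ω)) Q ∧
      ∫ ω, Complex.exp (β * coord h t ω) ∂Q =
        Complex.exp (t * (laplaceExponent ν (β + c) - laplaceExponent ν c)) := by
  obtain ⟨hi, he⟩ := hX.integral_exp hβ t
  have hm : Measurable fun x : ℝ => Complex.exp (β * x) := by fun_prop
  have hmX := (measurable_coord h t).aemeasurable (μ := Q)
  have hmX' := (measurable_coord h t).aemeasurable
    (μ := P.withDensity fun ω => expDensity c (laplaceExponentReal ν c) t (coord h t ω))
  have hD : Measurable fun ω => expDensity c (laplaceExponentReal ν c) t (coord h t ω) :=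
    (measurable_expDensity _ _ t).comp (measurable_coord h t)
  have hlt : ∀ᵐ ω ∂P, expDensity c (laplaceExponentReal ν c) t (coord h t ω) < ⊤ :=
    ae_of_all _ fun ω => ENNReal.ofReal_lt_top
  have e : ∀ ω, (expDensity c (laplaceExponentReal ν c) t (coord h t ω)).toReal •
      Complex.exp (β * coord h t ω) =
      Complex.exp (-(t * laplaceExponent ν c)) * Complex.exp ((β + c) * coord h t ω) := by
    intro ω
    rw [expDensity, ENNReal.toReal_ofReal (Real.exp_pos _).le, Complex.real_smul,
      laplaceExponent_ofReal, Complex.ofReal_exp, ← Complex.exp_add, ← Complex.exp_add]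
    push_cast
    ring_nf
  constructor
  · have := (integrable_map_measure (μ := Q) hm.aestronglyMeasurable hmX).1
    refine this ?_
    rw [hQ.map_coord, integrable_map_measure hm.aestronglyMeasurable hmX',
      integrable_withDensity_iff_integrable_smul' hD hlt]
    simp only [Function.comp_apply, e]
    exact hi.const_mul _
  · have := integral_map hmX (f := fun x : ℝ => Complex.exp (β * x)) hm.aestronglyMeasurable
    rw [← this, hQ.map_coord, integral_map hmX' hm.aestronglyMeasurable,
      integral_withDensity_eq_integral_toReal_smul hD hlt]
    simp only [e]
    rw [integral_const_mul, he, ← Complex.exp_add]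
    ring_nf

end

/-! ### The tilted Lévy measure -/

/-- The measure with density `exp(c x)` with respect to `ν`. -/
noncomputable def expTilt (ν : Measure ℝ) (c : ℝ) : Measure ℝ :=
  ν.withDensity fun x => ENNReal.ofReal (Real.exp (c * x))

section

variable {ν : Measure ℝ} {c : ℝ}

theorem expTilt_absolutelyContinuous (ν : Measure ℝ) (c : ℝ) : expTilt ν c ≪ ν :=
  withDensity_absolutelyContinuous _ _

/-- The density is strictly positive. Mutual absolute continuity preserves supports, hence the
lattice and skip-free conditions. -/
theorem absolutelyContinuous_expTilt (ν : Measure ℝ) (c : ℝ) : ν ≪ expTilt ν c :=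
  withDensity_absolutelyContinuous' (by fun_prop)
    (ae_of_all _ fun x => (ENNReal.ofReal_pos.2 (Real.exp_pos _)).ne')

theorem isFiniteMeasure_expTilt (hc : Integrable (fun x : ℝ => Real.exp (c * x)) ν) :
    IsFiniteMeasure (expTilt ν c) :=
  isFiniteMeasure_withDensity_ofReal hc.2

theorem support_expTilt (ν : Measure ℝ) (c : ℝ) : (expTilt ν c).support = ν.support :=
  Set.Subset.antisymm (expTilt_absolutelyContinuous ν c).support_mono
    (absolutelyContinuous_expTilt ν c).support_mono

theorem support_restrict_expTilt (ν : Measure ℝ) (c : ℝ) (s : Set ℝ) :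
    ((expTilt ν c).restrict s).support = (ν.restrict s).support :=
  Set.Subset.antisymm ((expTilt_absolutelyContinuous ν c).restrict s).support_mono
    ((absolutelyContinuous_expTilt ν c).restrict s).support_mono

theorem integral_expTilt (ν : Measure ℝ) (c : ℝ) (f : ℝ → ℂ) :
    ∫ x, f x ∂(expTilt ν c) = ∫ x, Complex.exp (c * x) * f x ∂ν := by
  rw [expTilt, integral_withDensity_eq_integral_toReal_smul (by fun_prop)
    (ae_of_all _ fun x => ENNReal.ofReal_lt_top)]
  refine integral_congr_ae (ae_of_all _ fun x => ?_)
  simp only [ENNReal.toReal_ofReal (Real.exp_pos _).le, Complex.real_smul]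
  push_cast
  rfl

theorem integral_expTilt_exp_sub_one [IsFiniteMeasure ν]
    {β : ℂ} (hc : Integrable (fun x : ℝ => Complex.exp (c * x)) ν)
    (hβ : Integrable (fun x : ℝ => Complex.exp ((β + c) * x)) ν) :
    laplaceExponent (expTilt ν c) β = laplaceExponent ν (β + c) - laplaceExponent ν c := by
  have hβ' : Integrable (fun x : ℝ => Complex.exp ((β + c) * x) - 1) ν :=
    hβ.sub (integrable_const _)
  have hc' : Integrable (fun x : ℝ => Complex.exp (c * x) - 1) ν := hc.sub (integrable_const _)
  rw [laplaceExponent, integral_expTilt, laplaceExponent, laplaceExponent,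
    ← integral_sub hβ' hc']
  refine integral_congr_ae (ae_of_all _ fun x => ?_)
  simp only
  rw [add_mul, Complex.exp_add]
  ring

end

section

variable {h : ℝ} {P Q : Measure (PathSpace h)} {ν : Measure ℝ} {c : ℝ}

theorem IsUpwardsSkipFreeLevyChain.ae_le {Ω : Type*} {m : MeasurableSpace Ω}
    {𝔽 : Filtration ℝ≥0 m} {X : ℝ≥0 → Ω → ℝ} {P : Measure Ω}
    (hX : IsUpwardsSkipFreeLevyChain 𝔽 X P ν h) : ∀ᵐ x ∂ν, x ≤ h :=
  ae_le_of_support_restrict hX.support_restrict hX.pos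

theorem IsUpwardsSkipFreeLevyChain.expTilt
    (hX : IsUpwardsSkipFreeLevyChain (canonicalFiltration h) (coord h) P ν h) (hc : 0 ≤ c)
    (hQ : IsExpChange h P c (laplaceExponentReal ν c) Q) :
    IsUpwardsSkipFreeLevyChain (canonicalFiltration h) (coord h) Q (expTilt ν c) h := by
  have hfin := hX.isCompoundPoisson.isFiniteMeasure
  have hcr : Integrable (fun x : ℝ => Complex.exp (c * x)) ν :=
    integrable_cexp_of_ae_le hX.ae_le (by simpa)
  have h1 := hX.isCompoundPoisson.lintegral_expDensity hcr
  refine ⟨⟨hQ.isLevyProcess hX.isCompoundPoisson.isLevyProcess h1,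
    isFiniteMeasure_expTilt (integrable_exp_of_ae_le hX.ae_le hc), ?_, ?_, ?_⟩, hX.pos, ?_, ?_⟩
  · intro h0
    refine hX.isCompoundPoisson.ne_zero (Measure.absolutelyContinuous_zero_iff.1 ?_)
    exact h0 ▸ absolutelyContinuous_expTilt ν c
  · exact expTilt_absolutelyContinuous ν c hX.isCompoundPoisson.no_atom_zero
  · intro t p
    have hβ : Integrable (fun x : ℝ => Complex.exp ((Complex.I * p + c) * x)) ν :=
      integrable_cexp_of_ae_le hX.ae_le (by simpa)
    have := (hQ.integral_exp hX.isCompoundPoisson hβ t).2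
    rw [← integral_expTilt_exp_sub_one hcr hβ] at this
    rw [charFun_apply_real, integral_map (measurable_coord h t).aemeasurable (by fun_prop)]
    refine Eq.trans (integral_congr_ae (ae_of_all _ fun ω => ?_)) this
    simp only
    ring_nf
  · rw [support_expTilt]
    exact hX.support_subset
  · rw [support_restrict_expTilt]
    exact hX.support_restrict

theorem IsCompoundPoisson.levyMeasure_unique {Ω : Type*} {m : MeasurableSpace Ω}
    {𝔽 : Filtration ℝ≥0 m} {X : ℝ≥0 → Ω → ℝ} {P : Measure Ω} {μ : Measure ℝ}
    (hν : IsCompoundPoisson 𝔽 X P ν) (hμ : IsCompoundPoisson 𝔽 X P μ) : μ = ν := by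
  have := hν.isFiniteMeasure
  have := hμ.isFiniteMeasure
  refine measure_eq_of_integral_exp_sub_one_eq hμ.no_atom_zero hν.no_atom_zero fun p => ?_
  exact exp_mul_sub_injective fun t => (hμ.charFun_eq t p).symm.trans (hν.charFun_eq t p)

end

/-! ### Drift to infinity -/

theorem exp_mul_sub_one_div_le {θ : ℝ} (h0 : 0 < θ) (h1 : θ ≤ 1) (x : ℝ) :
    (Real.exp (θ * x) - 1) / θ ≤ Real.exp x - 1 := by
  have := convexOn_exp.2 (Set.mem_univ x) (Set.mem_univ 0) h0.le (sub_nonneg.2 h1) (by ring)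
  simp only [smul_eq_mul, mul_zero, add_zero, Real.exp_zero, mul_one] at this
  rw [div_le_iff₀ h0]
  linarith

theorem tendsto_exp_mul_sub_one_div (x : ℝ) :
    Tendsto (fun n : ℕ => (Real.exp (1 / ((n : ℝ) + 1) * x) - 1) / (1 / ((n : ℝ) + 1)))
      atTop (𝓝 x) := by
  have hd : HasDerivAt (fun θ : ℝ => Real.exp (θ * x)) x 0 := by
    simpa using ((hasDerivAt_id (0 : ℝ)).mul_const x).exp
  have ht : Tendsto (fun n : ℕ => 1 / ((n : ℝ) + 1)) atTop (𝓝[≠] 0) :=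
    tendsto_nhdsWithin_iff.2 ⟨tendsto_one_div_add_atTop_nhds_zero_nat,
      Eventually.of_forall fun n => (one_div_pos.2 n.cast_add_one_pos).ne'⟩
  refine ((hasDerivAt_iff_tendsto_slope.1 hd).comp ht).congr fun n => ?_
  simp [slope_def_field]

/-- A random variable whose moment generating function grows at least linearly on the right of `0`
is integrable with positive mean. -/
theorem integrable_of_mgf_ge {Ω : Type*} {m : MeasurableSpace Ω} {P : Measure Ω}
    [IsProbabilityMeasure P] {Y : Ω → ℝ} (hY : Measurable Y) {ε : ℝ}
    (hi : ∀ θ, 0 ≤ θ → Integrable (fun ω => Real.exp (θ * Y ω)) P)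
    (hε : ∀ θ, 0 ≤ θ → 1 + ε * θ ≤ ∫ ω, Real.exp (θ * Y ω) ∂P) :
    Integrable Y P ∧ ε ≤ ∫ ω, Y ω ∂P := by
  have hi1' : Integrable (fun ω => Real.exp (Y ω)) P := by simpa using hi 1 zero_le_one
  have hi1 : Integrable (fun ω => Real.exp (Y ω) - 1) P := hi1'.sub (integrable_const 1)
  set K := ∫ ω, (Real.exp (Y ω) - 1) ∂P with hK
  have hKε : ε ≤ K := by
    have := hε 1 zero_le_one
    simp only [one_mul, mul_one] at this
    rw [hK, integral_sub hi1' (integrable_const _)]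
    simp
    linarith
  set θ : ℕ → ℝ := fun n => 1 / ((n : ℝ) + 1)
  have hθ0 : ∀ n, 0 < θ n := fun n => one_div_pos.2 n.cast_add_one_pos
  have hθ1 : ∀ n, θ n ≤ 1 := fun n => by
    rw [div_le_one n.cast_add_one_pos]
    simp
  -- By convexity these are nonnegative, and they converge to exp(Y) - 1 - Y. Fatou therefore
  -- controls the negative part of Y with no integrability assumed beforehand.
  set f : ℕ → Ω → ℝ := fun n ω => Real.exp (Y ω) - 1 - (Real.exp (θ n * Y ω) - 1) / θ n
  have hf0 : ∀ n ω, 0 ≤ f n ω := fun n ω =>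
    sub_nonneg.2 (exp_mul_sub_one_div_le (hθ0 n) (hθ1 n) _)
  have hfm : ∀ n, Measurable fun ω => ENNReal.ofReal (f n ω) := fun n => by fun_prop
  have hflim : ∀ ω, Tendsto (fun n => ENNReal.ofReal (f n ω)) atTop
      (𝓝 (ENNReal.ofReal (Real.exp (Y ω) - 1 - Y ω))) := fun ω =>
    ENNReal.tendsto_ofReal ((tendsto_exp_mul_sub_one_div (Y ω)).const_sub _)
  have hfint : ∀ n, ∫⁻ ω, ENNReal.ofReal (f n ω) ∂P ≤ ENNReal.ofReal (K - ε) := fun n => by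
    have hin := hi (θ n) (hθ0 n).le
    have hin' : Integrable (fun ω => (Real.exp (θ n * Y ω) - 1) / θ n) P :=
      (hin.sub (integrable_const 1)).div_const _
    have hfi : Integrable (f n) P := hi1.sub hin'
    rw [← ofReal_integral_eq_lintegral_ofReal hfi (ae_of_all _ (hf0 n))]
    refine ENNReal.ofReal_le_ofReal ?_
    simp only [f]
    rw [integral_sub hi1 hin', integral_div, integral_sub hin (integrable_const _)]
    simp only [integral_const, probReal_univ, smul_eq_mul, mul_one]
    have : ε ≤ (∫ ω, Real.exp (θ n * Y ω) ∂P - 1) / θ n := by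
      rw [le_div_iff₀ (hθ0 n)]
      linarith [hε (θ n) (hθ0 n).le]
    linarith
  have hZ0 : ∀ ω, 0 ≤ Real.exp (Y ω) - 1 - Y ω := fun ω => by
    linarith [Real.add_one_le_exp (Y ω)]
  have hfatou : ∫⁻ ω, ENNReal.ofReal (Real.exp (Y ω) - 1 - Y ω) ∂P ≤ ENNReal.ofReal (K - ε) := by
    calc _ = ∫⁻ ω, liminf (fun n => ENNReal.ofReal (f n ω)) atTop ∂P :=
          lintegral_congr fun ω => (hflim ω).liminf_eq.symm
      _ ≤ liminf (fun n => ∫⁻ ω, ENNReal.ofReal (f n ω) ∂P) atTop := lintegral_liminf_le hfm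
      _ ≤ _ := by
          refine liminf_le_of_le (by isBoundedDefault) fun b hb => ?_
          obtain ⟨n, hn⟩ := hb.exists
          exact hn.trans (hfint n)
  have hZ : Integrable (fun ω => Real.exp (Y ω) - 1 - Y ω) P := by
    refine ⟨by fun_prop, ?_⟩
    rw [hasFiniteIntegral_iff_ofReal (ae_of_all _ hZ0)]
    exact hfatou.trans_lt ENNReal.ofReal_lt_top
  have hYe : ∀ ω, Y ω = (Real.exp (Y ω) - 1) - (Real.exp (Y ω) - 1 - Y ω) := fun ω => by ring
  refine ⟨(hi1.sub hZ).congr (ae_of_all _ fun ω => (hYe ω).symm), ?_⟩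
  have hYint : ∫ ω, Y ω ∂P = K - ∫ ω, (Real.exp (Y ω) - 1 - Y ω) ∂P := by
    rw [← integral_sub hi1 hZ]
    exact integral_congr_ae (ae_of_all _ hYe)
  rw [← ofReal_integral_eq_lintegral_ofReal hZ (ae_of_all _ hZ0),
    ENNReal.ofReal_le_ofReal_iff (by linarith)] at hfatou
  linarith

section

variable {Ω : Type*} {m : MeasurableSpace Ω} {𝔽 : Filtration ℝ≥0 m} {X : ℝ≥0 → Ω → ℝ}
  {P : Measure Ω}

theorem IsLevyProcess.tendsto_div_nat (hX : IsLevyProcess 𝔽 X P) (hi : Integrable (X 1) P) :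
    ∀ᵐ ω ∂P, Tendsto (fun n : ℕ => X n ω / n) atTop (𝓝 (∫ ω, X 1 ω ∂P)) := by
  have hprob := hX.isProbabilityMeasure
  have hm : ∀ {s t}, s ≤ t → Measurable[𝔽 t] (X s) := fun hst =>
    (hX.adapted _).mono (𝔽.mono hst) le_rfl
  have hm' : ∀ t, Measurable (X t) := fun t => (hX.adapted t).mono (𝔽.le t) le_rfl
  set ξ : ℕ → Ω → ℝ := fun n ω => X ((n : ℝ≥0) + 1) ω - X n ω
  have hid : ∀ i, IdentDistrib (ξ i) (X 1) P P := fun i =>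
    ⟨((hm' _).sub (hm' _)).aemeasurable, (hm' 1).aemeasurable, hX.stationary i 1⟩
  have hindep : ∀ {i j : ℕ}, i < j → IndepFun (ξ i) (ξ j) P := fun {i j} hij => by
    refine (indep_of_indep_of_le_right (hX.indep j 1) ?_).symm
    have hij' : (i : ℝ≥0) + 1 ≤ j := by exact_mod_cast hij
    exact (Measurable.sub (hm hij') (hm (le_trans (by simp) hij'))).comap_le
  have hpair : Pairwise (Function.onFun (fun f g => IndepFun f g P) ξ) := fun i j hij => by
    rcases hij.lt_or_gt with h | h
    exacts [hindep h, (hindep h).symm]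
  have hslln := strong_law_ae_real ξ ((hid 0).integrable_iff.2 hi) hpair
    fun i => (hid i).trans (hid 0).symm
  rw [(hid 0).integral_eq] at hslln
  filter_upwards [hslln, hX.zero] with ω hω h0
  refine hω.congr fun n => ?_
  have := Finset.sum_range_sub (fun j : ℕ => X (j : ℝ≥0) ω) n
  simp only [Nat.cast_add, Nat.cast_one, Nat.cast_zero, h0, sub_zero] at this
  rw [this]

/-- After visiting `(-∞, M)` at one of finitely many times before `b`, the process is unlikely to be
above `a` at time `b`. -/
theorem IsLevyProcess.measure_exists_lt_inter_le (hX : IsLevyProcess 𝔽 X P) {p : ℝ≥0∞} {a M : ℝ}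
    {b : ℝ≥0} {J : Finset ℝ≥0} (hJb : ∀ s ∈ J, s ≤ b)
    (hp : ∀ s ∈ J, P {ω | a - M ≤ X (b - s) ω} ≤ p) :
    P ({ω | ∃ s ∈ J, X s ω < M} ∩ {ω | a ≤ X b ω}) ≤ p * P {ω | ∃ s ∈ J, X s ω < M} := by
  induction J using Finset.induction_on_max with
  | empty => simp
  | insert r J hJ ih =>
    have hm : ∀ {s t}, s ≤ t → Measurable[𝔽 t] (X s) := fun hst =>
      (hX.adapted _).mono (𝔽.mono hst) le_rfl
    have hm' : ∀ t, Measurable (X t) := fun t => (hX.adapted t).mono (𝔽.le t) le_rfl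
    set E : Set Ω := {ω | ∃ s ∈ J, X s ω < M}
    -- The first visit occurs at the largest time r. Reaching a at time b then needs an increment
    -- above a - M, independent of this event.
    set A : Set Ω := Eᶜ ∩ {ω | X r ω < M}
    have hE : MeasurableSet[𝔽 r] E := by
      have e : E = ⋃ s ∈ J, {ω | X s ω < M} := by ext; simp [E]
      rw [e]
      refine MeasurableSet.biUnion J.countable_toSet fun s hs => ?_
      exact hm (hJ s hs).le measurableSet_Iio
    have hA : MeasurableSet[𝔽 r] A := hE.compl.inter (hm le_rfl measurableSet_Iio)
    have hEA : {ω | ∃ s ∈ insert r J, X s ω < M} = E ∪ A := by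
      ext ω
      simp only [Finset.exists_mem_insert, Set.mem_ofPred_eq, Set.mem_union, Set.mem_inter_iff,
        Set.mem_compl_iff, E, A]
      generalize (∃ x ∈ J, X x ω < M) = q
      tauto
    have hdisj : Disjoint E A := Set.disjoint_left.2 fun ω h1 h2 => h2.1 h1
    rw [hEA, measure_union hdisj (𝔽.le r _ hA), mul_add, Set.union_inter_distrib_right]
    refine (measure_union_le _ _).trans (add_le_add
      (ih (fun s hs => hJb s (Finset.mem_insert_of_mem hs))
        (fun s hs => hp s (Finset.mem_insert_of_mem hs))) ?_)
    have hrb := hJb r (Finset.mem_insert_self r J)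
    have hind := hX.indep r (b - r)
    have hstat := hX.stationary r (b - r)
    rw [add_tsub_cancel_of_le hrb] at hind hstat
    have hd : Measurable fun ω => X b ω - X r ω := (hm' b).sub (hm' r)
    calc P (A ∩ {ω | a ≤ X b ω})
        ≤ P ((fun ω => X b ω - X r ω) ⁻¹' Set.Ici (a - M) ∩ A) := by
          refine measure_mono fun ω hω => ⟨?_, hω.1⟩
          have h1 : X r ω < M := hω.1.2
          have h2 : a ≤ X b ω := hω.2
          simp only [Set.mem_preimage, Set.mem_Ici]
          linarith
      _ = P {ω | a - M ≤ X (b - r) ω} * P A := by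
          rw [(Indep_iff _ _ P).1 hind _ _ ⟨_, measurableSet_Ici, rfl⟩ hA,
            ← Measure.map_apply hd measurableSet_Ici, hstat,
            Measure.map_apply (hm' _) measurableSet_Ici]
          rfl
      _ ≤ p * P A := by
          gcongr
          exact hp r (Finset.mem_insert_self r J)

/-- The same for all times in `[n, b)`, when the paths are right-continuous. -/
theorem IsLevyProcess.measure_exists_Ico_lt_inter_le (hX : IsLevyProcess 𝔽 X P)
    (hrc : ∀ ω t, ContinuousWithinAt (fun s => X s ω) (Set.Ici t) t) {p : ℝ≥0∞} {a M : ℝ}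
    {n b : ℝ≥0} (hp : ∀ s, n ≤ s → s ≤ b → P {ω | a - M ≤ X (b - s) ω} ≤ p) :
    P ({ω | ∃ s, n ≤ s ∧ s < b ∧ X s ω < M} ∩ {ω | a ≤ X b ω}) ≤ p := by
  have hprob := hX.isProbabilityMeasure
  classical
  -- By right-continuity a visit below M lasts for a short interval, which contains a point of the
  -- dense sequence.
  set q := TopologicalSpace.denseSeq ℝ≥0
  set J : ℕ → Finset ℝ≥0 := fun k => ((Finset.range k).image q).filter fun s => n ≤ s ∧ s ≤ b
  set E : ℕ → Set Ω := fun k => {ω | ∃ s ∈ J k, X s ω < M} ∩ {ω | a ≤ X b ω}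
  have hmono : Monotone E := fun k l hkl => Set.inter_subset_inter_left _ fun ω => by
    rintro ⟨s, hs, hsM⟩
    exact ⟨s, Finset.filter_subset_filter _ (Finset.image_subset_image
      (Finset.range_subset_range.2 hkl)) hs, hsM⟩
  have hE : ∀ k, P (E k) ≤ p := fun k => by
    have hJ : ∀ s ∈ J k, n ≤ s ∧ s ≤ b := fun s hs => (Finset.mem_filter.1 hs).2
    calc P (E k) ≤ p * P {ω | ∃ s ∈ J k, X s ω < M} :=
          hX.measure_exists_lt_inter_le (fun s hs => (hJ s hs).2)
            fun s hs => hp s (hJ s hs).1 (hJ s hs).2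
      _ ≤ p * 1 := by gcongr; exact prob_le_one
      _ = p := mul_one p
  calc _ ≤ P (⋃ k, E k) := by
        refine measure_mono ?_
        rintro ω ⟨⟨s, hns, hsb, hsM⟩, hωa⟩
        have hev : ∀ᶠ u in 𝓝[>] s, X u ω < M ∧ u ∈ Set.Ioo s b :=
          ((((hrc ω s).mono Set.Ioi_subset_Ici_self).eventually (gt_mem_nhds hsM))).and
            (Ioo_mem_nhdsGT hsb)
        obtain ⟨r, hr, hru⟩ := mem_nhdsGT_iff_exists_Ioo_subset.1 hev
        obtain ⟨k, hu⟩ := (TopologicalSpace.denseRange_denseSeq ℝ≥0).exists_mem_open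
          isOpen_Ioo (Set.nonempty_Ioo.2 hr)
        have h2 := hru hu
        refine Set.mem_iUnion.2 ⟨k + 1, ⟨q k, ?_, h2.1⟩, hωa⟩
        exact Finset.mem_filter.2 ⟨Finset.mem_image_of_mem q (by simp),
          hns.trans h2.2.1.le, h2.2.2.le⟩
    _ = ⨆ k, P (E k) := hmono.measure_iUnion
    _ ≤ p := iSup_le hE

/-- A Lévy process with exponential moments whose Laplace exponent has a positive right slope at `0`
drifts to infinity. -/
theorem IsLevyProcess.tendsto_atTop (hX : IsLevyProcess 𝔽 X P)
    (hrc : ∀ ω t, ContinuousWithinAt (fun s => X s ω) (Set.Ici t) t) {φ : ℝ → ℝ} {ε : ℝ}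
    (hε : 0 < ε) (hi : ∀ θ, 0 ≤ θ → ∀ t, Integrable (fun ω => Real.exp (θ * X t ω)) P)
    (he : ∀ θ, 0 ≤ θ → ∀ t : ℝ≥0, ∫ ω, Real.exp (θ * X t ω) ∂P = Real.exp (t * φ θ))
    (hφ : ∀ θ, 0 ≤ θ → ε * θ ≤ φ θ) :
    ∀ᵐ ω ∂P, Tendsto (fun t => X t ω) atTop atTop := by
  have hprob := hX.isProbabilityMeasure
  obtain ⟨hint, hmean⟩ := integrable_of_mgf_ge (ε := ε) ((hX.adapted 1).mono (𝔽.le 1) le_rfl)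
    (fun θ hθ => hi θ hθ 1) fun θ hθ => by
      rw [he θ hθ]
      have := Real.add_one_le_exp (φ θ)
      simp only [NNReal.coe_one, one_mul]
      linarith [hφ θ hθ]
  have hφ1 : 0 ≤ φ 1 := by linarith [hφ 1 zero_le_one]
  -- Chernoff's bound at θ = 1, uniform over durations up to one.
  have htail : ∀ (x : ℝ) (u : ℝ≥0), u ≤ 1 →
      P {ω | x ≤ X u ω} ≤ ENNReal.ofReal (Real.exp (-x) * Real.exp (φ 1)) := fun x u hu => by
    have h1 := measure_ge_le_exp_mul_mgf (μ := P) (X := X u) x zero_le_one (hi 1 zero_le_one u)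
    rw [mgf, he 1 zero_le_one, neg_one_mul] at h1
    rw [← ofReal_measureReal]
    refine ENNReal.ofReal_le_ofReal (h1.trans ?_)
    gcongr
    exact mul_le_of_le_one_left hφ1 (by exact_mod_cast hu)
  -- Borel–Cantelli: being below M within [n, n + 1) and above εn/2 at time n + 1 requires a large
  -- rise in at most unit time, with geometrically small probability.
  have hBC : ∀ M : ℕ, ∀ᵐ ω ∂P, ∀ᶠ n : ℕ in atTop,
      ω ∉ {ω | ∃ s, (n : ℝ≥0) ≤ s ∧ s < n + 1 ∧ X s ω < M} ∩
        {ω | ε / 2 * n ≤ X ((n : ℝ≥0) + 1) ω} := fun M => by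
    refine ae_eventually_notMem (ne_top_of_le_ne_top ?_ (ENNReal.tsum_le_tsum fun n =>
      hX.measure_exists_Ico_lt_inter_le hrc (p := ENNReal.ofReal
        (Real.exp (-(ε / 2 * n - M)) * Real.exp (φ 1))) fun s hs _ => htail _ _ ?_))
    · have hsum : Summable fun n : ℕ => Real.exp (-(ε / 2 * n - M)) * Real.exp (φ 1) := by
        have hg : Summable fun n : ℕ => Real.exp (-(ε / 2)) ^ n :=
          summable_geometric_of_lt_one (Real.exp_pos _).le (Real.exp_lt_one_iff.2 (by linarith))
        refine ((hg.mul_left (Real.exp M)).mul_right (Real.exp (φ 1))).congr fun n => ?_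
        rw [← Real.exp_nat_mul, ← Real.exp_add (M : ℝ)]
        ring_nf
      rw [← ENNReal.ofReal_tsum_of_nonneg (fun n => by positivity) hsum]
      exact ENNReal.ofReal_ne_top
    · rw [tsub_le_iff_left]
      gcongr
  filter_upwards [hX.tendsto_div_nat hint, ae_all_iff.2 hBC] with ω hω hωM
  -- The mean is at least ε; halving it leaves room for the limit in the strong law.
  have hlin : ∀ᶠ n : ℕ in atTop, ε / 2 * n ≤ X n ω := by
    filter_upwards [hω.eventually (lt_mem_nhds (show ε / 2 < _ by linarith)), eventually_gt_atTop 0]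
      with n hn h0
    have : (0 : ℝ) < n := by exact_mod_cast h0
    exact ((lt_div_iff₀ this).1 hn).le
  rw [Filter.tendsto_atTop]
  intro M
  obtain ⟨M', hM'⟩ := exists_nat_ge M
  obtain ⟨N, hN⟩ := eventually_atTop.1 ((hωM M').and hlin)
  filter_upwards [eventually_ge_atTop (N : ℝ≥0)] with t ht
  have hNt : N ≤ ⌊t⌋₊ := Nat.le_floor ht
  refine hM'.trans ?_
  by_contra! hlt
  refine (hN _ hNt).1 ⟨⟨t, Nat.floor_le zero_le, Nat.lt_floor_add_one t, hlt⟩, ?_⟩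
  have := (hN (⌊t⌋₊ + 1) (hNt.trans (Nat.le_succ _))).2
  rw [Nat.cast_add_one, Nat.cast_add_one] at this
  refine le_trans ?_ this
  gcongr
  linarith

end

theorem IsUpwardsSkipFreeLevyChain.tendsto_atTop {h : ℝ} {P Q : Measure (PathSpace h)}
    {ν : Measure ℝ} {c : ℝ}
    (hX : IsUpwardsSkipFreeLevyChain (canonicalFiltration h) (coord h) P ν h) (hc : 0 ≤ c)
    (hQ : IsExpChange h P c (laplaceExponentReal ν c) Q) (hr : largestRoot ν ≤ c)
    (hne : ¬ (c = 0 ∧ HasDerivWithinAt (laplaceExponentReal ν) 0 (Set.Ici 0) 0)) :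
    ∀ᵐ ω ∂Q, Tendsto (fun t : ℝ≥0 => coord h t ω) atTop atTop := by
  have hfin := hX.isCompoundPoisson.isFiniteMeasure
  obtain ⟨ε, hε, hslope⟩ := exists_pos_slope_laplaceExponentReal hX.ae_le hX.pos
    (measure_singleton_pos_of_support_restrict hX.support_restrict) hc hr hne
  have key : ∀ θ : ℝ, 0 ≤ θ → ∀ t, Integrable (fun ω => Real.exp (θ * coord h t ω)) Q ∧
      ∫ ω, Real.exp (θ * coord h t ω) ∂Q =
        Real.exp (t * (laplaceExponentReal ν (c + θ) - laplaceExponentReal ν c)) := by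
    intro θ hθ t
    have hβ : Integrable (fun x : ℝ => Complex.exp (((θ : ℂ) + c) * x)) ν :=
      integrable_cexp_of_ae_le hX.ae_le (by simpa using add_nonneg hθ hc)
    obtain ⟨hi, he⟩ := hQ.integral_exp hX.isCompoundPoisson hβ t
    have hre : ∀ ω, Complex.exp (θ * coord h t ω) = ((Real.exp (θ * coord h t ω) : ℝ) : ℂ) :=
      fun ω => by push_cast; rfl
    simp only [hre] at hi he
    refine ⟨hi.re, ?_⟩
    rw [integral_complex_ofReal, add_comm (θ : ℂ), ← Complex.ofReal_add, laplaceExponent_ofReal,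
      laplaceExponent_ofReal] at he
    exact_mod_cast he
  have hchain := hX.expTilt hc hQ
  have hlevy := hchain.isCompoundPoisson.isLevyProcess
  exact hlevy.tendsto_atTop (fun ω => ω.2.2.1) hε
    (fun θ hθ t => (key θ hθ t).1) (fun θ hθ t => (key θ hθ t).2) hslope

/-! ### Stopping times -/

/-- The multiples of `1 / (l + 1)`. -/
noncomputable def gridPoint (l k : ℕ) : ℝ≥0 := (k + 1) / (l + 1)

/-- The index of the grid interval that contains `s`. -/
noncomputable def gridIndex (l : ℕ) (s : ℝ≥0) : ℕ := ⌊s * (l + 1)⌋₊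

/-- The smallest multiple of `1 / (l + 1)` that is larger than `s`. -/
noncomputable def gridAbove (l : ℕ) (s : ℝ≥0) : ℝ≥0 := gridPoint l (gridIndex l s)

theorem measurable_gridIndex (l : ℕ) : Measurable (gridIndex l) :=
  Nat.measurable_floor.comp (measurable_id.mul_const _)

theorem measurable_apply_nat {α Ω β : Type*} [MeasurableSpace α] [MeasurableSpace Ω]
    [MeasurableSpace β] {Y : ℕ → Ω → β} (hY : ∀ k, Measurable (Y k)) {k : α → ℕ} {g : α → Ω}
    (hk : Measurable k) (hg : Measurable g) : Measurable fun a => Y (k a) (g a) :=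
  (measurable_from_prod_countable_right hY (f := fun q : ℕ × Ω => Y q.1 q.2)).comp (hk.prodMk hg)

theorem lt_gridAbove (l : ℕ) (s : ℝ≥0) : s < gridAbove l s := by
  rw [gridAbove, gridPoint, lt_div_iff₀ (by positivity)]
  exact Nat.lt_floor_add_one _

theorem gridAbove_le (l : ℕ) (s : ℝ≥0) : gridAbove l s ≤ s + 1 / (l + 1) := by
  rw [gridAbove, gridPoint, add_div]
  gcongr
  rw [div_le_iff₀ (by positivity)]
  exact Nat.floor_le zero_le

theorem tendsto_gridAbove (s : ℝ≥0) :
    Tendsto (fun l => gridAbove l s) atTop (𝓝[≥] s) := by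
  refine tendsto_nhdsWithin_iff.2 ⟨?_, Eventually.of_forall fun l => (lt_gridAbove l s).le⟩
  refine tendsto_of_tendsto_of_tendsto_of_le_of_le tendsto_const_nhds ?_
    (fun l => (lt_gridAbove l s).le) (fun l => gridAbove_le l s)
  have : Tendsto (fun l : ℕ => 1 / ((l : ℝ≥0) + 1)) atTop (𝓝 0) :=
    tendsto_one_div_add_atTop_nhds_zero_nat
  simpa using this.const_add s

theorem measurable_uncurry_of_rightContinuous {Ω : Type*} [MeasurableSpace Ω] {X : ℝ≥0 → Ω → ℝ}
    {i : ℝ≥0} (hX : ∀ t ≤ i, Measurable (X t))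
    (hrc : ∀ ω t, ContinuousWithinAt (fun s => X s ω) (Set.Ici t) t) :
    Measurable fun p : Set.Iic i × Ω => X p.1 p.2 := by
  refine measurable_of_tendsto_metrizable
    -- Grid times approach from the right and take countably many values; capping at i keeps
    -- everything measurable at time i.
    (f := fun (l : ℕ) (p : Set.Iic i × Ω) => X (min (gridAbove l p.1) i) p.2) (fun l => ?_) ?_
  · exact measurable_apply_nat (Y := fun k ω => X (min (gridPoint l k) i) ω)
      (fun k => hX (min (gridPoint l k) i) (min_le_right _ _))
      ((measurable_gridIndex l).comp (measurable_subtype_coe.comp measurable_fst)) measurable_snd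
  · rw [tendsto_pi_nhds]
    rintro ⟨⟨s, hs⟩, ω⟩
    have hs : s ≤ i := hs
    refine (hrc ω s).tendsto.comp (tendsto_nhdsWithin_iff.2 ⟨?_, Eventually.of_forall fun l =>
      le_min (lt_gridAbove l s).le hs⟩)
    have := ((tendsto_gridAbove s).mono_right inf_le_left).min (tendsto_const_nhds (x := i))
    rwa [min_eq_left hs] at this

theorem isStronglyProgressive_of_rightContinuous {Ω : Type*} {m : MeasurableSpace Ω}
    {𝔽 : Filtration ℝ≥0 m} {X : ℝ≥0 → Ω → ℝ} (hX : ∀ t, Measurable[𝔽 t] (X t))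
    (hrc : ∀ ω t, ContinuousWithinAt (fun s => X s ω) (Set.Ici t) t) :
    IsStronglyProgressive 𝔽 X := fun i =>
  (@measurable_uncurry_of_rightContinuous Ω (𝔽 i) X i
    (fun t ht => (hX t).mono (𝔽.mono ht) le_rfl) hrc).stronglyMeasurable

section

variable {Ω : Type*} {m : MeasurableSpace Ω} {𝔽 : Filtration ℝ≥0 m} {T : Ω → WithTop ℝ≥0}
  {A : Set Ω}

theorem MeasureTheory.IsStoppingTime.measurable_untopA (hT : IsStoppingTime 𝔽 T) :
    Measurable[hT.measurableSpace] fun ω => (T ω).untopA :=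
  hT.measurable.untopA

theorem measurableSet_inter_gridIndex_eq (hT : IsStoppingTime 𝔽 T)
    (hA : MeasurableSet[hT.measurableSpace] A) (l k : ℕ) :
    MeasurableSet[𝔽 (gridPoint l k)]
      (A ∩ {ω | T ω < ⊤} ∩ {ω | gridIndex l (T ω).untopA = k}) := by
  set d : ℝ≥0 := gridPoint l k with hd
  set e : ℝ≥0 := (k : ℝ≥0) / (l + 1)
  have hed : e ≤ d := by simp only [e, d, gridPoint]; gcongr; simp
  have hpos : (0 : ℝ≥0) < l + 1 := by positivity
  -- The index is k exactly when e ≤ T < d, which is decided at time d.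
  have heq : A ∩ {ω | T ω < ⊤} ∩ {ω | gridIndex l (T ω).untopA = k} =
      (A ∩ {ω | T ω ≤ d}) ∩ {ω | T ω < d} ∩ {ω | T ω < e}ᶜ := by
    ext ω
    simp only [Set.mem_inter_iff, Set.mem_ofPred_eq, Set.mem_compl_iff, not_lt]
    cases hω : T ω with
    | top =>
      simp only [lt_self_iff_false, and_false, false_and, false_iff]
      rintro ⟨⟨-, h2⟩, -⟩
      exact not_top_lt h2
    | coe t =>
      have hu : (t : WithTop ℝ≥0).untopA = t := rfl
      simp only [WithTop.coe_lt_top, and_true, hu, WithTop.coe_le_coe,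
        WithTop.coe_lt_coe]
      rw [gridIndex, hd, gridPoint, Nat.floor_eq_iff zero_le, div_le_iff₀ hpos, lt_div_iff₀ hpos, le_div_iff₀ hpos]
      constructor
      · rintro ⟨h1, h2, h3⟩
        exact ⟨⟨⟨h1, h3.le⟩, h3⟩, h2⟩
      · rintro ⟨⟨⟨h1, -⟩, h3⟩, h2⟩
        exact ⟨h1, h2, h3⟩
  rw [heq]
  exact ((hA.2 d).inter (hT.measurableSet_lt d)).inter
    (𝔽.mono hed _ (hT.measurableSet_lt e)).compl

/-- A right-continuous density process, stopped at `T`, is at most a density on `ℱ_T`. -/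
theorem setLIntegral_stopped_le {P Q : Measure Ω} {D : ℝ≥0 → Ω → ℝ≥0∞}
    (hD : ∀ t, Measurable (D t))
    (hrc : ∀ ω t, ContinuousWithinAt (fun s => D s ω) (Set.Ici t) t)
    (hQ : ∀ t Λ, MeasurableSet[𝔽 t] Λ → Q Λ = ∫⁻ ω in Λ, D t ω ∂P)
    (hT : IsStoppingTime 𝔽 T) (hA : MeasurableSet[hT.measurableSpace] A) :
    ∫⁻ ω in A ∩ {ω | T ω < ⊤}, D (T ω).untopA ω ∂P ≤ Q (A ∩ {ω | T ω < ⊤}) := by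
  set B : Set Ω := A ∩ {ω | T ω < ⊤}
  set k : ℕ → Ω → ℕ := fun l ω => gridIndex l (T ω).untopA
  have hk : ∀ l, Measurable (k l) := fun l => (measurable_gridIndex l).comp
    (hT.measurable_untopA.mono hT.measurableSpace_le le_rfl)
  set C : ℕ → ℕ → Set Ω := fun l j => B ∩ {ω | k l ω = j}
  have hC : ∀ l j : ℕ, MeasurableSet[𝔽 (gridPoint l j)] (C l j) :=
    fun l j => measurableSet_inter_gridIndex_eq hT hA l j
  have hC' : ∀ l j, MeasurableSet (C l j) := fun l j => 𝔽.le _ _ (hC l j)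
  have hunion : ∀ l, B = ⋃ j, C l j := fun l => by
    ext ω
    simp [C]
  have hdisj : ∀ l, Pairwise (Function.onFun Disjoint (C l)) := fun l i j hij =>
    Set.disjoint_left.2 fun ω h1 h2 => hij (h1.2.symm.trans h2.2)
  -- On each cell the grid time is deterministic, so the density formula holds with equality. Only
  -- the limit in l, by Fatou, loses it.
  have hgrid : ∀ l, ∫⁻ ω in B, D (gridAbove l (T ω).untopA) ω ∂P = Q B := fun l => by
    rw [hunion l, measure_iUnion (hdisj l) (hC' l), lintegral_iUnion (hC' l) (hdisj l)]
    congr 1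
    ext j
    rw [hQ _ _ (hC l j)]
    refine setLIntegral_congr_fun (hC' l j) fun ω hω => ?_
    have : k l ω = j := hω.2
    simp only [gridAbove]
    rw [show gridIndex l (T ω).untopA = j from this]
  have hmeas : ∀ l, Measurable fun ω => D (gridAbove l (T ω).untopA) ω := fun l =>
    measurable_apply_nat (fun j => hD (gridPoint l j)) (hk l) measurable_id
  calc ∫⁻ ω in B, D (T ω).untopA ω ∂P
      = ∫⁻ ω in B, liminf (fun l => D (gridAbove l (T ω).untopA) ω) atTop ∂P :=
        lintegral_congr fun ω =>
          ((hrc ω _).tendsto.comp (tendsto_gridAbove (T ω).untopA)).liminf_eq.symm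
    _ ≤ liminf (fun l => ∫⁻ ω in B, D (gridAbove l (T ω).untopA) ω ∂P) atTop :=
        lintegral_liminf_le hmeas
    _ = Q B := by simp only [hgrid, liminf_const]

end

theorem expDensity_mul_neg (c ψ : ℝ) (t : ℝ≥0) (x : ℝ) :
    expDensity c ψ t x * expDensity (-c) (-ψ) t x = 1 := by
  rw [expDensity, expDensity, ← ENNReal.ofReal_mul (Real.exp_pos _).le, ← Real.exp_add]
  ring_nf
  simp

section

variable {h : ℝ} {P Q : Measure (PathSpace h)} {c ψ : ℝ}

/-- The reciprocal density has the same form, so one-sided estimates can be used in both directions.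
-/
theorem IsExpChange.symm (hQ : IsExpChange h P c ψ Q) : IsExpChange h Q (-c) (-ψ) P := by
  intro t Λ hΛ
  have hΛ' := (canonicalFiltration h).le t _ hΛ
  rw [← lintegral_indicator hΛ', hQ.lintegral_eq (t := t)
    (Measurable.indicator (measurable_expDensity_coord (-c) (-ψ) le_rfl) hΛ),
    ← lintegral_indicator_one hΛ']
  refine lintegral_congr fun ω => ?_
  by_cases hω : ω ∈ Λ
  · simp [hω, expDensity_mul_neg]
  · simp [hω]

theorem continuousWithinAt_expDensity_coord (c ψ : ℝ) (ω : PathSpace h) (t : ℝ≥0) :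
    ContinuousWithinAt (fun s => expDensity c ψ s (coord h s ω)) (Set.Ici t) t := by
  have h1 : ContinuousWithinAt (fun s => coord h s ω) (Set.Ici t) t := ω.2.2.1 t
  have h2 : ContinuousWithinAt (fun s : ℝ≥0 => (s : ℝ)) (Set.Ici t) t :=
    NNReal.continuous_coe.continuousWithinAt
  exact ENNReal.continuous_ofReal.continuousAt.comp_continuousWithinAt
    (Real.continuous_exp.continuousAt.comp_continuousWithinAt
      ((h1.const_mul c).sub (h2.const_mul ψ)))

/-- Right-continuous adapted processes are progressive, so their stopped values are ℱ_T-measurable.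
-/
theorem measurable_stopped_expDensity (c ψ : ℝ) {T : PathSpace h → WithTop ℝ≥0}
    (hT : IsStoppingTime (canonicalFiltration h) T) :
    Measurable[hT.measurableSpace]
      fun ω => expDensity c ψ (T ω).untopA (coord h (T ω).untopA ω) := by
  have hv : Measurable[hT.measurableSpace] (stoppedValue (coord h) T) :=
    measurable_stoppedValue (isStronglyProgressive_of_rightContinuous
      (fun t => measurable_coord_canonicalFiltration h le_rfl) fun ω => ω.2.2.1) hT
  have hu : Measurable[hT.measurableSpace] fun ω => (((T ω).untopA : ℝ≥0) : ℝ) :=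
    measurable_coe_nnreal_real.comp hT.measurable_untopA
  exact ENNReal.measurable_ofReal.comp
    (Real.measurable_exp.comp ((hv.const_mul c).sub (hu.const_mul ψ)))

theorem IsExpChange.setLIntegral_stopped_le (hQ : IsExpChange h P c ψ Q)
    {T : PathSpace h → WithTop ℝ≥0} (hT : IsStoppingTime (canonicalFiltration h) T)
    {A : Set (PathSpace h)} (hA : MeasurableSet[hT.measurableSpace] A) :
    ∫⁻ ω in A ∩ {ω | T ω < ⊤}, expDensity c ψ (T ω).untopA (coord h (T ω).untopA ω) ∂P ≤
      Q (A ∩ {ω | T ω < ⊤}) :=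
  _root_.setLIntegral_stopped_le (D := fun t ω => expDensity c ψ t (coord h t ω))
    (fun t => (measurable_expDensity c ψ t).comp (measurable_coord h t))
    (continuousWithinAt_expDensity_coord c ψ) hQ hT hA

/-- The density formula at a stopping time. -/
theorem IsExpChange.measure_eq_setLIntegral_stopped (hQ : IsExpChange h P c ψ Q)
    {T : PathSpace h → WithTop ℝ≥0} (hT : IsStoppingTime (canonicalFiltration h) T)
    {A : Set (PathSpace h)} (hA : MeasurableSet[hT.measurableSpace] A) :
    Q (A ∩ {ω | T ω < ⊤}) =
      ∫⁻ ω in A ∩ {ω | T ω < ⊤}, expDensity c ψ (T ω).untopA (coord h (T ω).untopA ω) ∂P := by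
  refine le_antisymm ?_ (hQ.setLIntegral_stopped_le hT hA)
  have hle := hT.measurableSpace_le
  set S : Set (PathSpace h) := {ω | T ω < ⊤} with hSdef
  have hS : MeasurableSet[hT.measurableSpace] S := by
    have : S = {ω | T ω = ⊤}ᶜ := by ext ω; simp [S, lt_top_iff_ne_top]
    rw [this]
    exact (hT.measurable (measurableSet_singleton ⊤)).compl
  have hAS : MeasurableSet[hT.measurableSpace] (A ∩ S) := hA.inter hS
  set D : PathSpace h → ℝ≥0∞ := fun ω => expDensity c ψ (T ω).untopA (coord h (T ω).untopA ω)
  set D' : PathSpace h → ℝ≥0∞ :=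
    fun ω => expDensity (-c) (-ψ) (T ω).untopA (coord h (T ω).untopA ω)
  have hD : Measurable[hT.measurableSpace] D := measurable_stopped_expDensity c ψ hT
  have hD' : Measurable[hT.measurableSpace] D' := measurable_stopped_expDensity (-c) (-ψ) hT
  set ρ : Measure (PathSpace h) := (Q.restrict S).withDensity D'
  -- The Fatou inequality for the reversed pair. It holds on ℱ_T only, hence the trims; integrating
  -- the ℱ_T-measurable D, reciprocal to D', gives the missing bound.
  have hρ : ρ.trim hle ≤ P.trim hle := by
    refine @Measure.le_intro _ hT.measurableSpace _ _ fun E hE _ => ?_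
    rw [trim_measurableSet_eq hle hE, trim_measurableSet_eq hle hE,
      withDensity_apply _ (hle _ hE), Measure.restrict_restrict (hle _ hE)]
    exact (hQ.symm.setLIntegral_stopped_le hT hE).trans (measure_mono Set.inter_subset_left)
  have hf : Measurable[hT.measurableSpace] ((A ∩ S).indicator D) := hD.indicator hAS
  calc Q (A ∩ S) = ∫⁻ ω, (A ∩ S).indicator D ω ∂ρ := by
        rw [lintegral_withDensity_eq_lintegral_mul _ (hD'.mono hle le_rfl)
          (hf.mono hle le_rfl), ← lintegral_indicator (hle _ hS),
          ← lintegral_indicator_one (hle _ hAS)]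
        refine lintegral_congr fun ω => ?_
        by_cases hω : ω ∈ A ∩ S
        · have : D ω * D' ω = 1 := expDensity_mul_neg _ _ _ _
          rw [mul_comm] at this
          simp [hω, hω.2, this]
        · by_cases hωS : ω ∈ S <;> simp [hω, hωS]
    _ = ∫⁻ ω, (A ∩ S).indicator D ω ∂(ρ.trim hle) := (lintegral_trim hle hf).symm
    _ ≤ ∫⁻ ω, (A ∩ S).indicator D ω ∂(P.trim hle) := lintegral_mono' hρ le_rfl
    _ = ∫⁻ ω, (A ∩ S).indicator D ω ∂P := lintegral_trim hle hf
    _ = ∫⁻ ω in A ∩ S, D ω ∂P := lintegral_indicator (hle _ hAS) _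

end

theorem mainTheorem10 (h : ℝ) (P : Measure (PathSpace h)) (ν : Measure ℝ)
    (hX : IsUpwardsSkipFreeLevyChain (canonicalFiltration h) (coord h) P ν h)
    (c : ℝ) (hc : 0 ≤ c) :
    ∃ Pc : Measure (PathSpace h),
      -- the defining property, and uniqueness among all measures
      IsExponentialChange h P ν c Pc ∧
      (∀ Q : Measure (PathSpace h), IsExponentialChange h P ν c Q → Q = Pc) ∧
      -- under the new measure the coordinate process is an upwards skip-free chain
      (∃ νc : Measure ℝ,
        IsUpwardsSkipFreeLevyChain (canonicalFiltration h) (coord h) Pc νc h) ∧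
      -- Laplace exponent
      HasLaplaceExponent (coord h) Pc
        (fun β => laplaceExponent ν (β + c) - laplaceExponent ν c) ∧
      -- the new Lévy measure, with its Laplace exponent and its density
      (∀ νc : Measure ℝ, IsCompoundPoisson (canonicalFiltration h) (coord h) Pc νc →
        (∀ β : ℂ, 0 ≤ β.re →
          laplaceExponent νc β = laplaceExponent ν (β + c) - laplaceExponent ν c) ∧
        νc ≪ ν ∧ νc.rnDeriv ν =ᵐ[ν] fun x => ENNReal.ofReal (Real.exp (c * x))) ∧
      -- drift to infinity, unless `c = 0` and the right derivative of `ψ` at `0` vanishes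
      (largestRoot ν ≤ c →
        ¬ (c = 0 ∧ HasDerivWithinAt (laplaceExponentReal ν) 0 (Set.Ici 0) 0) →
        ∀ᵐ ω ∂Pc, Tendsto (fun t : ℝ≥0 => coord h t ω) atTop atTop) ∧
      -- stopping times: absolute continuity, measurability of the density, density formula
      (∀ (T : PathSpace h → WithTop ℝ≥0) (hT : IsStoppingTime (canonicalFiltration h) T),
        (∀ A : Set (PathSpace h), MeasurableSet[hT.measurableSpace] A →
          P (A ∩ {ω | T ω < ⊤}) = 0 → Pc (A ∩ {ω | T ω < ⊤}) = 0) ∧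
        Measurable[hT.measurableSpace] ({ω | T ω < ⊤}.indicator (stoppedDensity h ν c T)) ∧
        (∀ A : Set (PathSpace h), MeasurableSet[hT.measurableSpace] A →
          Pc (A ∩ {ω | T ω < ⊤}) =
            ∫⁻ ω in A ∩ {ω | T ω < ⊤}, stoppedDensity h ν c T ω ∂P)) := by

  have hfin := hX.isCompoundPoisson.isFiniteMeasure
  have hcr : Integrable (fun x : ℝ => Complex.exp (c * x)) ν :=
    integrable_cexp_of_ae_le hX.ae_le (by simpa)
  have hβ : ∀ β : ℂ, 0 ≤ β.re → Integrable (fun x : ℝ => Complex.exp ((β + c) * x)) ν :=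
    fun β hβ => integrable_cexp_of_ae_le hX.ae_le (by simpa using add_nonneg hβ hc)
  have h1 := hX.isCompoundPoisson.lintegral_expDensity hcr
  obtain ⟨Pc, hPc⟩ :=
    exists_measure_eq_setLIntegral_expDensity hX.isCompoundPoisson.isLevyProcess h1
  have hPc : IsExpChange h P c (laplaceExponentReal ν c) Pc := hPc
  have hchain := hX.expTilt hc hPc
  refine ⟨Pc, hPc, fun Q hQ => IsExpChange.unique hQ hPc h1, ⟨_, hchain⟩, ?_, ?_, ?_, ?_⟩
  · exact fun β hβ0 t => hPc.integral_exp hX.isCompoundPoisson (hβ β hβ0) t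
  · intro νc hνc
    -- Any Lévy measure of X under the new law is the tilted one.
    obtain rfl := hchain.isCompoundPoisson.levyMeasure_unique hνc
    refine ⟨fun β hβ0 => integral_expTilt_exp_sub_one hcr (hβ β hβ0),
      expTilt_absolutelyContinuous ν c, ?_⟩
    exact Measure.rnDeriv_withDensity ν (by fun_prop)
  · exact hX.tendsto_atTop hc hPc
  · intro T hT
    have hS : MeasurableSet[hT.measurableSpace] {ω | T ω < ⊤} := by
      have : {ω | T ω < ⊤} = {ω | T ω = ⊤}ᶜ := by ext ω; simp [lt_top_iff_ne_top]
      rw [this]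
      exact (hT.measurable (measurableSet_singleton ⊤)).compl
    have hform : ∀ A : Set (PathSpace h), MeasurableSet[hT.measurableSpace] A →
        Pc (A ∩ {ω | T ω < ⊤}) =
          ∫⁻ ω in A ∩ {ω | T ω < ⊤}, stoppedDensity h ν c T ω ∂P := fun A hA =>
      hPc.measure_eq_setLIntegral_stopped hT hA
    refine ⟨fun A hA hPA => ?_, ?_, hform⟩
    · rw [hform A hA]
      exact setLIntegral_measure_zero _ _ hPA
    · exact (measurable_stopped_expDensity c (laplaceExponentReal ν c) hT).indicator hS
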